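/- **Theorem (Helicity Invariance Theorem).** Regard $S^3$ as the unit quaternions with the round metric and volume form $\mu$. Let $\mathrm{pr}:S^3\setminus\{1\}\to\mathbb R^3$ be stereographic projection from $1$, let $\mathrm{Conf}_3(S^3)\subset (S^3)^3$ be the set of triples of distinct points, let $$H:\mathrm{Conf}_3(S^3)\to S^2,\qquad H(x,y,z)=\frac{\mathrm{pr}(x^{-1}y)-\mathrm{pr}(x^{-1}z)}{\|\mathrm{pr}(x^{-1}y)-\mathrm{pr}(x^{-1}z)\|},$$ and let $\omega=H^*\nu\in\Omega^2(\mathrm{Conf}_3(S^3))$, where $\nu$ is the area form of $S^2$. Let $\mathcal T_1,\mathcal T_2,\mathcal T_3\subset S^3$ be pairwise disjoint handlebodies with smooth boundary, and write $\mathcal T=\mathcal T_1\times\mathcal T_2\times\mathcal T_3\subset\mathrm{Conf}_3(S^3)$. Call $\mathcal T$ an *unlinked handlebody* if $\omega$ is exact on $\mathcal T$, i.e. if there is a *potential* $\alpha\in\Omega^1(\mathcal T)$ with $d\alpha=\omega$ on $\mathcal T$. Let $B$ be a smooth vector field on $S^3$ whose flow preserves the volume; call the unlinked handlebody $\mathcal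 T$ *invariant* under $B$ if $B$ is tangent to $\partial\mathcal T_i$ for $i=1,2,3$. Put $B_i=B|_{\mathcal T_i}$, and let $\mu_i$ be the pull-back of $\mu$ under the $i$-th projection $(S^3)^3\to S^3$. For such a pair $(B;\mathcal T)$ and a potential $\alpha$ define $$\mathsf H_{123}(B;\mathcal T)=\int_{\mathcal T}(\alpha\wedge d\alpha)\wedge\iota_{B_1}\mu_1\wedge\iota_{B_2}\mu_2\wedge\iota_{B_3}\mu_3 ,$$ where $(S^3)^3$ is oriented by $\mu_1\wedge\mu_2\wedge\mu_3$. Then the integral converges absolutely and (i) $\mathsf H_{123}(B;\mathcal T)$ does not depend on the choice of the potential $\alpha$ of $\omega$ on $\mathcal T$; (ii) for every volume-preserving diffeomorphism $g$ of $S^3$ that is smoothly isotopic to the identity, $g_*B$ is again a smooth volume-preserving vector field, $g(\mathcal T)=g(\mathcal T_1)\times g(\mathcal T_2)\times g(\mathcal T_3)$ is again an unlinked handlebody, invariant under $g_*B$, and $$\mathsf H_{123}(B;\mathcal T)=\mathsf H_{123}(g_*B;g(\mathcal T)).$$ -/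

import Mathlib

open scoped Manifold ContDiff Quaternion
open MeasureTheory

noncomputable section

namespace Helicity

/-! ### The round three-sphere of unit quaternions and its cube -/

instance instMeasurableSpaceQuaternion : MeasurableSpace ℍ[ℝ] := borel _

instance instBorelSpaceQuaternion : BorelSpace ℍ[ℝ] := ⟨rfl⟩

instance instFactFinrankQuaternion : Fact (Module.finrank ℝ ℍ[ℝ] = 3 + 1) :=
  ⟨Quaternion.finrank_eq_four⟩

/-- The unit sphere `S³` of the quaternions, with Mathlib's smooth structure. -/
abbrev S3 : Type := Metric.sphere (0 : ℍ[ℝ]) 1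

/-- The Riemannian (surface) measure of the round sphere `S³`. -/
def vol : Measure S3 := (volume : Measure ℍ[ℝ]).toSphere

/-- The ambient vector space `ℍ × ℍ × ℍ` of `S³ × S³ × S³`. -/
abbrev Amb : Type := Fin 3 → ℍ[ℝ]

/-- The inclusion `S³ × S³ × S³ → ℍ × ℍ × ℍ`. -/
def incl (p : Fin 3 → S3) : Amb := fun i => (p i : ℍ[ℝ])

/-- The product measure on `S³ × S³ × S³`. -/
def vol3 : Measure (Fin 3 → S3) := Measure.pi fun _ => vol

/-- The product `T₁ × T₂ × T₃`. -/
def prodDomain (T : Fin 3 → Set S3) : Set (Fin 3 → S3) := Set.univ.pi T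

/-- `u` is tangent to `S³ × S³ × S³` at `p`. -/
def IsTangent (p : Fin 3 → S3) (u : Amb) : Prop :=
  ∀ i, inner ℝ (p i : ℍ[ℝ]) (u i) = 0

/-! ### Linear algebra of alternating forms -/

/-- The wedge product of alternating forms (sum over shuffles, no numerical factor). -/
def wedge {V : Type*} [AddCommGroup V] [Module ℝ V] {k l : ℕ}
    (a : V [⋀^Fin k]→ₗ[ℝ] ℝ) (b : V [⋀^Fin l]→ₗ[ℝ] ℝ) : V [⋀^Fin (k + l)]→ₗ[ℝ] ℝ :=
  ((LinearMap.mul' ℝ ℝ).compAlternatingMap (a.domCoprod b)).domDomCongr finSumFinEquiv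

/-- The determinant form of the quaternions, with respect to the basis `1, i, j, k`. -/
def detH : ℍ[ℝ] [⋀^Fin 4]→ₗ[ℝ] ℝ :=
  ((EuclideanSpace.basisFun (Fin 4) ℝ).map Quaternion.linearIsometryEquivTuple.symm).toBasis.det

/-- The volume form `μ` of `S³`: `μ_x(u, v, w) = det(x, u, v, w)` for `u, v, w` tangent at `x`. -/
def volForm (x : S3) : ℍ[ℝ] [⋀^Fin 3]→ₗ[ℝ] ℝ := detH.curryLeft (x : ℍ[ℝ])

/-- The area form `ν` of `S² ⊂ ℝ³`: `ν_n(u, v) = det(n, u, v)` for `u, v` tangent at `n`. -/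
def areaForm (n : EuclideanSpace ℝ (Fin 3)) : EuclideanSpace ℝ (Fin 3) [⋀^Fin 2]→ₗ[ℝ] ℝ :=
  (EuclideanSpace.basisFun (Fin 3) ℝ).toBasis.det.curryLeft n

/-! ### The map `H : Conf₃(S³) → S²` and the two-form `ω = H^* ν` -/

/-- Stereographic projection `S³ ∖ {1} → ℝ³` from `1`, by a formula that makes sense for all
quaternions of real part `≠ 1`. -/
def stereo (q : ℍ[ℝ]) : EuclideanSpace ℝ (Fin 3) :=
  (1 - q.re)⁻¹ • !₂[q.imI, q.imJ, q.imK]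

/-- `pr(x⁻¹ y) - pr(x⁻¹ z)`. -/
def confDiff (p : Amb) : EuclideanSpace ℝ (Fin 3) :=
  stereo ((p 0)⁻¹ * p 1) - stereo ((p 0)⁻¹ * p 2)

/-- The map `H(x, y, z) = (pr(x⁻¹ y) - pr(x⁻¹ z)) / ‖pr(x⁻¹ y) - pr(x⁻¹ z)‖`, given by a formula
that is smooth on a neighbourhood of `Conf₃(S³)` in the ambient space. -/
def confMap (p : Amb) : EuclideanSpace ℝ (Fin 3) := ‖confDiff p‖⁻¹ • confDiff p

/-- The two-form `ω = H^* ν` on `Conf₃(S³)`. -/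
def omega (p : Amb) : Amb [⋀^Fin 2]→ₗ[ℝ] ℝ :=
  (areaForm (confMap p)).compLinearMap (fderiv ℝ confMap p).toLinearMap

/-- `α` is a smooth one-form on `T₁ × T₂ × T₃` with `dα = ω` there. A smooth form on the domain
with corners `T₁ × T₂ × T₃ ⊂ (S³)³ ⊂ ℍ³` is represented by a form that is smooth on a
neighbourhood of it in the ambient space; only values on tangent vectors of `(S³)³` matter, and
`d` commutes with the restriction to `(S³)³`. -/
structure IsPotential (T : Fin 3 → Set S3) (α : Amb → Amb [⋀^Fin 1]→L[ℝ] ℝ) : Prop where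
  smooth : ∃ U : Set Amb, IsOpen U ∧ incl '' prodDomain T ⊆ U ∧ ContDiffOn ℝ ∞ α U
  extDeriv_eq : ∀ p ∈ prodDomain T, ∀ u v : Amb, IsTangent p u → IsTangent p v →
    extDeriv α (incl p) ![u, v] = omega (incl p) ![u, v]

/-! ### Vector fields and diffeomorphisms of `S³` -/

/-- Vector fields on `S³`. -/
abbrev VField : Type := (x : S3) → TangentSpace (𝓡 3) x

/-- `B` is a smooth vector field on `S³` whose flow preserves the volume. -/
structure IsSVect (B : VField) : Prop where
  smooth : ContMDiff (𝓡 3) (𝓡 3).tangent ∞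
    (fun x => (⟨x, B x⟩ : TangentBundle (𝓡 3) S3))
  flow : ∃ Φ : ℝ → S3 → S3, (∀ x, Φ 0 x = x) ∧
    (∀ x, IsMIntegralCurve (I := 𝓡 3) (fun t => Φ t x) B) ∧
    ∀ t, MeasurePreserving (Φ t) vol vol

/-- The value of a vector field on `S³` as a vector of the ambient space `ℍ`. -/
def ambVec (B : VField) (x : S3) : ℍ[ℝ] :=
  mfderiv (𝓡 3) 𝓘(ℝ, ℍ[ℝ]) (fun y : S3 => (y : ℍ[ℝ])) x (B x)

/-- Smooth diffeomorphisms of `S³`. -/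
abbrev DiffS3 : Type := Diffeomorph (𝓡 3) (𝓡 3) S3 S3 ∞

/-- The push-forward `g_* B`, that is, the pull-back of `B` by `g⁻¹`. -/
def pushForward (g : DiffS3) (B : VField) : VField :=
  VectorField.mpullback (𝓡 3) (𝓡 3) g.symm B

/-- `g` is a volume-preserving diffeomorphism that is smoothly isotopic to the identity. (The
diffeomorphisms in the isotopy need not preserve the volume.) -/
structure IsSDiff0 (g : DiffS3) : Prop where
  measurePreserving : MeasurePreserving g vol vol
  isotopic : ∃ G : ℝ → DiffS3,
    ContMDiffOn (𝓘(ℝ, ℝ).prod (𝓡 3)) (𝓡 3) ∞ (fun q : ℝ × S3 => G q.1 q.2)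
      (Set.Icc (0 : ℝ) 1 ×ˢ Set.univ) ∧
    (∀ x, G 0 x = x) ∧ ∀ x, G 1 x = g x

/-! ### Handlebodies in `S³` -/

/-- The model of a handlebody of genus `n`: a closed disc with `n` round holes, times `[0, 1]`. -/
def handlebodyModel (n : ℕ) : Set (ℂ × ℝ) :=
  (Metric.closedBall (0 : ℂ) (4 * (n + 1)) \
    ⋃ k ∈ Finset.Icc 1 n, Metric.ball (4 * (k : ℂ)) 1) ×ˢ Set.Icc (0 : ℝ) 1

/-- On the neighbourhood `U` of the boundary point `x`, the set `T` is `{f ≤ 0}` for a smooth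
function `f` with `f x = 0` and `df_x ≠ 0`. -/
structure IsBoundaryDefining (T : Set S3) (x : S3) (U : Set S3) (f : S3 → ℝ) : Prop where
  isOpen : IsOpen U
  mem : x ∈ U
  smooth : ContMDiffOn (𝓡 3) 𝓘(ℝ, ℝ) ∞ f U
  apply_eq_zero : f x = 0
  mfderiv_ne_zero : mfderiv (𝓡 3) 𝓘(ℝ, ℝ) f x ≠ 0
  mem_iff : ∀ y ∈ U, y ∈ T ↔ f y ≤ 0

/-- `T` is a handlebody in `S³` with smooth boundary. -/
structure IsHandlebody (T : Set S3) : Prop where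
  model : ∃ n : ℕ, Nonempty (T ≃ₜ handlebodyModel n)
  smooth_boundary : ∀ x ∈ frontier T, ∃ (U : Set S3) (f : S3 → ℝ), IsBoundaryDefining T x U f

/-- `B` is tangent to the boundary of `T`. -/
def IsTangentToBoundary (B : VField) (T : Set S3) : Prop :=
  ∀ x ∈ frontier T, ∀ (U : Set S3) (f : S3 → ℝ), IsBoundaryDefining T x U f →
    mfderiv (𝓡 3) 𝓘(ℝ, ℝ) f x (B x) = 0

/-- `T₁ × T₂ × T₃` is an unlinked handlebody, invariant under `B`. -/
structure IsInvariantUnlinkedHandlebody (B : VField) (T : Fin 3 → Set S3) : Prop where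
  disjoint : ∀ i j, i ≠ j → Disjoint (T i) (T j)
  handlebody : ∀ i, IsHandlebody (T i)
  exact : ∃ α, IsPotential T α
  tangent : ∀ i, IsTangentToBoundary B (T i)

/-! ### The helicity -/

/-- The two-form `ι_{B_i} μ_i = π_i^* (ι_B μ)` on `S³ × S³ × S³`. -/
def fluxForm (B : VField) (i : Fin 3) (p : Fin 3 → S3) : Amb [⋀^Fin 2]→ₗ[ℝ] ℝ :=
  ((volForm (p i)).curryLeft (ambVec B (p i))).compLinearMap (LinearMap.proj i)

/-- The nine-form `(α ∧ dα) ∧ ι_{B_1} μ_1 ∧ ι_{B_2} μ_2 ∧ ι_{B_3} μ_3`. -/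
def helicityForm (B : VField) (α : Amb → Amb [⋀^Fin 1]→L[ℝ] ℝ) (p : Fin 3 → S3) :
    Amb [⋀^Fin 9]→ₗ[ℝ] ℝ :=
  wedge (wedge (wedge (wedge (α (incl p)).toAlternatingMap (extDeriv α (incl p)).toAlternatingMap)
    (fluxForm B 0 p)) (fluxForm B 1 p)) (fluxForm B 2 p)

/-- The unit quaternions `i, j, k`. -/
def unitIJK : Fin 3 → ℍ[ℝ] := ![⟨0, 1, 0, 0⟩, ⟨0, 0, 1, 0⟩, ⟨0, 0, 0, 1⟩]

/-- The orthonormal frame `(xi, xj, xk, yi, yj, yk, zi, zj, zk)` of `S³ × S³ × S³` at `(x, y, z)`,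
positively oriented for `μ_1 ∧ μ_2 ∧ μ_3`. -/
def frame (p : Fin 3 → S3) (a : Fin 9) : Amb :=
  let b : Fin 3 × Fin 3 := finProdFinEquiv.symm a
  Pi.single b.1 ((p b.1 : ℍ[ℝ]) * unitIJK b.2)

/-- The density of a nine-form on `S³ × S³ × S³` with respect to the Riemannian volume form
`μ_1 ∧ μ_2 ∧ μ_3`. -/
def density (Θ : (Fin 3 → S3) → Amb [⋀^Fin 9]→ₗ[ℝ] ℝ) (p : Fin 3 → S3) : ℝ := Θ p (frame p)

/-- The integral of a nine-form over a subset of the oriented Riemannian manifold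
`S³ × S³ × S³`. -/
def integralForm (D : Set (Fin 3 → S3)) (Θ : (Fin 3 → S3) → Amb [⋀^Fin 9]→ₗ[ℝ] ℝ) : ℝ :=
  ∫ p in D, density Θ p ∂vol3

/-- The helicity `H₁₂₃(B; T)`, computed with the potential `α`. -/
def helicity (B : VField) (T : Fin 3 → Set S3) (α : Amb → Amb [⋀^Fin 1]→L[ℝ] ℝ) : ℝ :=
  integralForm (prodDomain T) (helicityForm B α)

end Helicity

end

open scoped Manifold ContDiff Quaternion
open MeasureTheory

noncomputable section

namespace Helicity

/-! The fields $B_1, B_2, B_3$ live in different factors of $(S^3)^3$. Wedging a three-form $\gamma$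
with the two-forms $\iota_{B_i}\mu_i$ gives $\gamma(B_1,B_2,B_3)$ times the volume form, so the
helicity is the integral of $(\alpha\wedge d\alpha)(B_1,B_2,B_3)$ (`density_helicityForm`), a
continuous function on a compact set. Only the values of forms on the $B_i$ matter.

Stokes' theorem on a domain with corners is replaced by the flow of $B$. Tangency to the boundary
makes each $\mathcal T_i$ invariant under the flow (`IsSVect.mem_of_integralCurve`). The flow in one
factor then preserves $\mathcal T$ and its measure, so the derivative of a function along $B_i$ has
integral zero (`integral_fderiv_slotVec`). As the $B_i$ commute, $d(A\wedge A')(B_1,B_2,B_3)$ is a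
sum of such derivatives, whence $\int A\wedge dA'=\int A'\wedge dA$ (`integral_wedgeSlots_comm`).
For two potentials this gives $\int\alpha\wedge d\alpha=\int\alpha\wedge d\alpha'=\int\alpha'\wedge
d\alpha=\int\alpha'\wedge d\alpha'$, which is (i).

For (ii), let $G_t$ be the isotopy and $F(t,p)=H(G_t p)$. Write $F^*\nu=\omega_t+dt\wedge\eta_t$.
Closedness gives $\partial_t\omega_t=d\eta_t$, so with $\kappa_t=\int_0^t\eta_s\,ds$ the form
$\alpha_t=\alpha+\kappa_t$ is a potential of $\omega_t$ (`extDerivOne_kappaForm`). The derivative of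
$\int\alpha_t\wedge d\alpha_t$ is $\int\eta_t\wedge\omega_t+\int\alpha_t\wedge
d\eta_t=2\int\eta_t\wedge\omega_t$. This vanishes because $\nu\wedge\nu=0$ (`wedgeArea_etaForm`).
Hence $\alpha$ and $\alpha_1$ have the same helicity (`integral_wedgeSlots_add_kappaForm`). Now
$\alpha_1$ is a potential of $\omega_1=g^*\omega$ on $\mathcal T$, and so is $g^*\alpha'$ for any
potential $\alpha'$ on $g(\mathcal T)$. The argument of (i) compares the two, and the change of
variables by $g$ finishes the proof. Only $g$, and not the maps $G_t$, has to preserve the volume.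
-/

open Filter Topology

/-! ### Wedge product with a two-form as a sum over shuffles -/

section Wedge

open Equiv TensorProduct

variable {V : Type*} [AddCommGroup V] [Module ℝ V] {k l : ℕ}

/-- The summand of the wedge product that belongs to the class `q` of permutations. -/
def wedgeSummand (a : V [⋀^Fin k]→ₗ[ℝ] ℝ) (b : V [⋀^Fin l]→ₗ[ℝ] ℝ) (w : Fin k ⊕ Fin l → V)
    (q : Perm.ModSumCongr (Fin k) (Fin l)) : ℝ :=
  LinearMap.mul' ℝ ℝ (AlternatingMap.domCoprod.summand a b q w)

theorem wedge_apply (a : V [⋀^Fin k]→ₗ[ℝ] ℝ) (b : V [⋀^Fin l]→ₗ[ℝ] ℝ) (v : Fin (k + l) → V) :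
    wedge a b v = ∑ q, wedgeSummand a b (v ∘ finSumFinEquiv) q := by
  simp only [wedge, AlternatingMap.domDomCongr_apply, LinearMap.compAlternatingMap_apply,
    AlternatingMap.domCoprod_apply, wedgeSummand, sum_apply, map_sum]

theorem wedgeSummand_mk (a : V [⋀^Fin k]→ₗ[ℝ] ℝ) (b : V [⋀^Fin l]→ₗ[ℝ] ℝ)
    (w : Fin k ⊕ Fin l → V) (σ : Perm (Fin k ⊕ Fin l)) :
    wedgeSummand a b w (QuotientGroup.mk σ) =
      ((Perm.sign σ : ℤ) : ℝ) * (a (fun i => w (σ (Sum.inl i))) * b (fun j => w (σ (Sum.inr j)))) := by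
  have := AlternatingMap.domCoprod.summand_mk'' a b σ
  rw [wedgeSummand]
  erw [this]
  rw [Units.smul_def, ← Int.cast_smul_eq_zsmul ℝ]
  change LinearMap.mul' ℝ ℝ (((Perm.sign σ : ℤ) : ℝ) •
    (a (fun i => w (σ (Sum.inl i))) ⊗ₜ[ℝ] b (fun j => w (σ (Sum.inr j))))) = _
  rw [map_smul, LinearMap.mul'_apply, smul_eq_mul]

/-- A class modulo permutations of the two blocks is determined by the set of arguments that the
second form receives. -/
theorem mk_eq_mk_of_mapsTo_inr {σ τ : Perm (Fin k ⊕ Fin l)}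
    (h : ∀ j, ∃ j', σ (Sum.inr j) = τ (Sum.inr j')) :
    (QuotientGroup.mk σ : Perm.ModSumCongr (Fin k) (Fin l)) = QuotientGroup.mk τ := by
  symm
  rw [QuotientGroup.eq]
  refine Perm.mem_sumCongrHom_range_of_perm_mapsTo_inl ?_
  rw [Perm.perm_mapsTo_inl_iff_mapsTo_inr]
  rintro _ ⟨j, rfl⟩
  obtain ⟨j', hj'⟩ := h j
  exact ⟨j', by simp [hj']⟩

theorem exists_of_mk_eq_mk {σ τ : Perm (Fin k ⊕ Fin l)}
    (h : (QuotientGroup.mk σ : Perm.ModSumCongr (Fin k) (Fin l)) = QuotientGroup.mk τ) (j : Fin l) :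
    ∃ j', τ (Sum.inr j) = σ (Sum.inr j') := by
  rw [QuotientGroup.eq] at h
  obtain ⟨⟨s, t⟩, h⟩ := h
  refine ⟨t j, ?_⟩
  have := Equiv.congr_fun h (Sum.inr j)
  rw [← Perm.inv_eq_iff_eq]
  simpa using this.symm

theorem wedge_two_apply (a : V [⋀^Fin k]→ₗ[ℝ] ℝ) (b : V [⋀^Fin 2]→ₗ[ℝ] ℝ) (x : Fin k)
    (v : Fin (k + 2) → V) (h : ∀ i, i ≠ x → ∀ u, b ![v (Fin.castAdd 2 i), u] = 0) :
    wedge a b v =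
      a (v ∘ Fin.castAdd 2) * b ![v (Fin.natAdd k 0), v (Fin.natAdd k 1)]
      - a (Function.update (v ∘ Fin.castAdd 2) x (v (Fin.natAdd k 0))) *
          b ![v (Fin.castAdd 2 x), v (Fin.natAdd k 1)]
      - a (Function.update (v ∘ Fin.castAdd 2) x (v (Fin.natAdd k 1))) *
          b ![v (Fin.natAdd k 0), v (Fin.castAdd 2 x)] := by
  classical
  have h' : ∀ i, i ≠ x → ∀ u, b ![u, v (Fin.castAdd 2 i)] = 0 := by
    intro i hi u
    have := b.map_swap ![v (Fin.castAdd 2 i), u] (i := 0) (j := 1) (by decide)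
    rw [h i hi u, neg_zero] at this
    rw [← this]
    congr 1
    ext j; fin_cases j <;> rfl
  set w := v ∘ finSumFinEquiv with hw
  have hb : ∀ σ : Perm (Fin k ⊕ Fin 2), b (fun j => w (σ (Sum.inr j))) =
      b ![w (σ (Sum.inr 0)), w (σ (Sum.inr 1))] := by
    intro σ; congr 1; ext j; fin_cases j <;> rfl
  have hwl : ∀ i, w (Sum.inl i) = v (Fin.castAdd 2 i) := fun i => rfl
  have hwr : ∀ i, w (Sum.inr i) = v (Fin.natAdd k i) := fun i => rfl
  let s : Fin 2 → Perm (Fin k ⊕ Fin 2) := fun j => swap (Sum.inl x) (Sum.inr j)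
  have s01 : s 0 (Sum.inr 1) = Sum.inr 1 := swap_apply_of_ne_of_ne (by simp) (by simp)
  have s00 : s 0 (Sum.inr 0) = Sum.inl x := swap_apply_right _ _
  have s10 : s 1 (Sum.inr 0) = Sum.inr 0 := swap_apply_of_ne_of_ne (by simp) (by simp)
  have s11 : s 1 (Sum.inr 1) = Sum.inl x := swap_apply_right _ _
  have hsl : ∀ j, (fun i => w (s j (Sum.inl i))) =
      Function.update (v ∘ Fin.castAdd 2) x (v (Fin.natAdd k j)) := by
    intro j; ext i
    by_cases hi : i = x
    · subst hi
      simp [s, hwr]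
    · rw [Function.update_of_ne hi]
      simp only [s]
      rw [swap_apply_of_ne_of_ne (by simpa using hi) (by simp)]; rfl
  let c : Perm (Fin k ⊕ Fin 2) → Perm.ModSumCongr (Fin k) (Fin 2) := fun σ => QuotientGroup.mk σ
  have hc01 : c 1 ≠ c (s 0) := by
    intro hc
    obtain ⟨j, hj⟩ := exists_of_mk_eq_mk hc 0
    simp [s00] at hj
  have hc02 : c 1 ≠ c (s 1) := by
    intro hc
    obtain ⟨j, hj⟩ := exists_of_mk_eq_mk hc 1
    simp [s11] at hj
  have hc12 : c (s 0) ≠ c (s 1) := by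
    intro hc
    obtain ⟨j, hj⟩ := exists_of_mk_eq_mk hc 0
    rw [s10] at hj
    fin_cases j
    · simp [s00] at hj
    · simp [s01] at hj
  -- The form `b` sees only argument `x` and the last two arguments, so at most three classes
  -- contribute: one for each pair among these three.
  rw [wedge_apply, ← Finset.sum_subset (Finset.subset_univ {c 1, c (s 0), c (s 1)})]
  · rw [Finset.sum_insert (by simp [hc01, hc02]), Finset.sum_pair hc12]
    simp only [c, wedgeSummand_mk]
    rw [hb, hb, hb, s00, s01, s10, s11, hsl, hsl]
    have hs : ∀ j, Perm.sign (s j) = -1 := fun j => Perm.sign_swap (by simp)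
    rw [hs, hs]
    simp only [Perm.sign_one, Perm.coe_one, id]
    simp only [hwr, hwl x]
    push_cast
    rw [show (fun i => w (Sum.inl i)) = v ∘ Fin.castAdd 2 from rfl]
    ring
  · intro q _ hq
    induction q using QuotientGroup.induction_on with | _ σ =>
    simp only [Finset.mem_insert, Finset.mem_singleton, not_or] at hq
    rw [wedgeSummand_mk]
    by_contra hne
    have hbne : b ![w (σ (Sum.inr 0)), w (σ (Sum.inr 1))] ≠ 0 := by
      intro h0; rw [hb, h0] at hne; simp at hne
    have key : ∀ j, σ (Sum.inr j) = Sum.inl x ∨ ∃ j', σ (Sum.inr j) = Sum.inr j' := by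
      intro j
      rcases hσ : σ (Sum.inr j) with i | j'
      · left
        by_contra hi
        have hi : i ≠ x := fun h => hi (by rw [h])
        apply hbne
        fin_cases j
        · simp only [Fin.zero_eta] at hσ
          rw [hσ]; exact h i hi _
        · simp only [Fin.mk_one] at hσ
          rw [hσ]; exact h' i hi _
      · exact Or.inr ⟨j', rfl⟩
    have hinj : σ (Sum.inr 0) ≠ σ (Sum.inr 1) := by simp
    have two : ∀ j : Fin 2, j = 0 ∨ j = 1 := by decide
    have aux : ∀ j j₀ j' : Fin 2, j ≠ j₀ → σ (Sum.inr j₀) = Sum.inl x → σ (Sum.inr j) = Sum.inr j' →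
        (QuotientGroup.mk σ : Perm.ModSumCongr (Fin k) (Fin 2)) = c (s 0) ∨
        (QuotientGroup.mk σ : Perm.ModSumCongr (Fin k) (Fin 2)) = c (s 1) := by
      intro j j₀ j' hj h0 h1
      have hcase : ∀ m, m = j₀ ∨ m = j := by
        exact (by decide : ∀ j j₀ : Fin 2, j ≠ j₀ → ∀ m, m = j₀ ∨ m = j) j j₀ hj
      rcases two j' with rfl | rfl
      · right
        refine mk_eq_mk_of_mapsTo_inr fun m => ?_
        rcases hcase m with rfl | rfl
        · exact ⟨1, by rw [h0, s11]⟩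
        · exact ⟨0, by rw [h1, s10]⟩
      · left
        refine mk_eq_mk_of_mapsTo_inr fun m => ?_
        rcases hcase m with rfl | rfl
        · exact ⟨0, by rw [h0, s00]⟩
        · exact ⟨1, by rw [h1, s01]⟩
    rcases key 0 with h0 | ⟨j0, h0⟩ <;> rcases key 1 with h1 | ⟨j1, h1⟩
    · exact hinj (h0.trans h1.symm)
    · rcases aux 1 0 j1 (by decide) h0 h1 with h | h
      · exact hq.2.1 h
      · exact hq.2.2 h
    · rcases aux 0 1 j0 (by decide) h1 h0 with h | h
      · exact hq.2.1 h
      · exact hq.2.2 h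
    · refine hq.1 (mk_eq_mk_of_mapsTo_inr fun m => ?_)
      rcases two m with rfl | rfl
      · exact ⟨j0, h0⟩
      · exact ⟨j1, h1⟩

end Wedge

/-! ### The helicity density as $(\alpha\wedge d\alpha)(B_1,B_2,B_3)$ -/

section Density

theorem detH_apply (v : Fin 4 → ℍ[ℝ]) :
    detH v = Matrix.det (Matrix.of fun i j => ![(v j).re, (v j).imI, (v j).imJ, (v j).imK] i) := by
  rw [detH, Module.Basis.det_apply]
  congr 1

theorem inner_coe_ambVec (B : VField) (x : S3) : inner ℝ (x : ℍ[ℝ]) (ambVec B x) = 0 := by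
  have h := (range_mvfderiv_subtypeVal x).le ⟨B x, rfl⟩
  exact Submodule.mem_orthogonal_singleton_iff_inner_right.1 h

theorem unitIJK_coords :
    ((unitIJK 0).re = 0 ∧ (unitIJK 0).imI = 1 ∧ (unitIJK 0).imJ = 0 ∧ (unitIJK 0).imK = 0) ∧
    ((unitIJK 1).re = 0 ∧ (unitIJK 1).imI = 0 ∧ (unitIJK 1).imJ = 1 ∧ (unitIJK 1).imK = 0) ∧
    ((unitIJK 2).re = 0 ∧ (unitIJK 2).imI = 0 ∧ (unitIJK 2).imJ = 0 ∧ (unitIJK 2).imK = 1) :=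
  ⟨⟨rfl, rfl, rfl, rfl⟩, ⟨rfl, rfl, rfl, rfl⟩, rfl, rfl, rfl, rfl⟩

theorem volForm_apply_mul (x : S3) (c : ℍ[ℝ]) (hc : c.re = 0) :
    volForm x ![x * c, x * unitIJK 1, x * unitIJK 2] = c.imI ∧
    volForm x ![x * c, x * unitIJK 0, x * unitIJK 2] = -c.imJ ∧
    volForm x ![x * c, x * unitIJK 1, x * unitIJK 0] = -c.imK := by
  have hx : (x : ℍ[ℝ]).re ^ 2 + (x : ℍ[ℝ]).imI ^ 2 + (x : ℍ[ℝ]).imJ ^ 2 + (x : ℍ[ℝ]).imK ^ 2 = 1 := by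
    rw [← Quaternion.normSq_def', Quaternion.normSq_eq_norm_mul_self]; simp
  -- Left multiplication by `x` on the quaternions has determinant $|x|^4$, so the squared
  -- normalisation is what the determinants below need.
  have hx2 : ((x : ℍ[ℝ]).re ^ 2 + (x : ℍ[ℝ]).imI ^ 2 + (x : ℍ[ℝ]).imJ ^ 2 + (x : ℍ[ℝ]).imK ^ 2) ^ 2 = 1 := by
    rw [hx]; simp
  have e : ∀ v, volForm x v = detH (Matrix.vecCons (x : ℍ[ℝ]) v) := fun v => rfl
  refine ⟨?_, ?_, ?_⟩ <;> rw [e, detH_apply] <;>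
    simp [Matrix.det_succ_row_zero, Fin.sum_univ_succ, Fin.succAbove, unitIJK_coords, hc]
  · linear_combination c.imI * hx2
  · linear_combination -c.imJ * hx2
  · linear_combination -c.imK * hx2

/-- Cramer's rule in the orthonormal frame `xi, xj, xk`. The signs and the order of the arguments
are those of the three shuffles in `wedge_two_apply`. -/
theorem eq_volForm_smul_frame (x : S3) (b : ℍ[ℝ]) (hb : inner ℝ (x : ℍ[ℝ]) b = 0) :
    b = volForm x ![b, x * unitIJK 1, x * unitIJK 2] • ((x : ℍ[ℝ]) * unitIJK 0)
      - volForm x ![b, x * unitIJK 0, x * unitIJK 2] • ((x : ℍ[ℝ]) * unitIJK 1)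
      - volForm x ![b, x * unitIJK 1, x * unitIJK 0] • ((x : ℍ[ℝ]) * unitIJK 2) := by
  obtain ⟨c, hc, rfl⟩ : ∃ c : ℍ[ℝ], c.re = 0 ∧ b = x * c := by
    refine ⟨star (x : ℍ[ℝ]) * b, ?_, ?_⟩
    · rw [Quaternion.inner_def] at hb
      simp only [Quaternion.re_mul, Quaternion.re_star, Quaternion.imI_star, Quaternion.imJ_star,
        Quaternion.imK_star] at hb ⊢
      linarith
    · rw [← mul_assoc, Quaternion.self_mul_star, Quaternion.normSq_eq_norm_mul_self]
      simp
  obtain ⟨h0, h1, h2⟩ := volForm_apply_mul x c hc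
  rw [h0, h1, h2, neg_smul, neg_smul, sub_neg_eq_add, sub_neg_eq_add, ← mul_smul_comm,
    ← mul_smul_comm, ← mul_smul_comm, ← mul_add, ← mul_add]
  congr 1
  ext <;> simp [unitIJK_coords, hc]

theorem fluxForm_apply (B : VField) (i : Fin 3) (p : Fin 3 → S3) (u v : Amb) :
    fluxForm B i p ![u, v] = volForm (p i) ![ambVec B (p i), u i, v i] := by
  simp only [fluxForm, AlternatingMap.compLinearMap_apply, AlternatingMap.curryLeft_apply_apply]
  congr 1
  ext1 j; fin_cases j <;> rfl

/-- The vector `B(p_i)` in the `i`-th factor of `S³ × S³ × S³`. -/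
def slotVec (B : VField) (p : Fin 3 → S3) (i : Fin 3) : Amb := Pi.single i (ambVec B (p i))

/-- The values of the flux form in the three surviving shuffles are the frame coefficients of $B$,
so linearity of `a` reassembles $B$ in place of the first frame vector of factor `i`. -/
theorem wedge_fluxForm_apply {k : ℕ} (a : Amb [⋀^Fin k]→ₗ[ℝ] ℝ) (B : VField) (i : Fin 3)
    (p : Fin 3 → S3) (x : Fin k) (v : Fin (k + 2) → Amb)
    (hx : v (Fin.castAdd 2 x) = Pi.single i ((p i : ℍ[ℝ]) * unitIJK 0))
    (h0 : v (Fin.natAdd k 0) = Pi.single i ((p i : ℍ[ℝ]) * unitIJK 1))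
    (h1 : v (Fin.natAdd k 1) = Pi.single i ((p i : ℍ[ℝ]) * unitIJK 2))
    (h : ∀ j, j ≠ x → v (Fin.castAdd 2 j) i = 0) :
    wedge a (fluxForm B i p) v = a (Function.update (v ∘ Fin.castAdd 2) x (slotVec B p i)) := by
  have hz : ∀ w y : ℍ[ℝ], volForm (p i) ![w, 0, y] = 0 := by
    intro w y
    exact (volForm (p i)).map_coord_zero 1 rfl
  rw [wedge_two_apply a _ x v
    (fun j hj u => by rw [fluxForm_apply, h j hj, hz])]
  rw [show v ∘ Fin.castAdd 2 = Function.update (v ∘ Fin.castAdd 2) x (v (Fin.castAdd 2 x)) by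
    rw [eq_comm, Function.update_eq_self_iff]; rfl]
  simp only [Function.update_idem, hx, h0, h1, fluxForm_apply, Pi.single_eq_same]
  have e := eq_volForm_smul_frame (p i) (ambVec B (p i)) (inner_coe_ambVec B (p i))
  rw [slotVec]
  conv_rhs => rw [e]
  rw [Pi.single_sub, Pi.single_sub, Pi.single_smul, Pi.single_smul, Pi.single_smul,
    AlternatingMap.map_update_sub, AlternatingMap.map_update_sub, AlternatingMap.map_update_smul,
    AlternatingMap.map_update_smul, AlternatingMap.map_update_smul]
  simp only [smul_eq_mul]
  ring

theorem wedge_fluxForms_frame (γ : Amb [⋀^Fin 3]→ₗ[ℝ] ℝ) (B : VField) (p : Fin 3 → S3) :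
    wedge (wedge (wedge γ (fluxForm B 0 p)) (fluxForm B 1 p)) (fluxForm B 2 p) (frame p) =
      γ ![slotVec B p 0, slotVec B p 1, slotVec B p 2] := by
  let e : Fin 3 → Fin 3 → Amb := fun i j => Pi.single i ((p i : ℍ[ℝ]) * unitIJK j)
  have he : frame p = ![e 0 0, e 0 1, e 0 2, e 1 0, e 1 1, e 1 2, e 2 0, e 2 1, e 2 2] := by
    ext1 a; fin_cases a <;> rfl
  rw [he]
  have h1 := wedge_fluxForm_apply (wedge (wedge γ (fluxForm B 0 p)) (fluxForm B 1 p)) B 2 p 6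
    ![e 0 0, e 0 1, e 0 2, e 1 0, e 1 1, e 1 2, e 2 0, e 2 1, e 2 2] rfl rfl rfl
    (by intro j hj; fin_cases j <;> first | rfl | exact absurd rfl hj)
  rw [h1]
  -- An even permutation brings the last two frame vectors of the next factor to the end, where the
  -- previous lemma expects them. The same is done once more with `τ'`.
  let τ : Equiv.Perm (Fin 7) := c[4, 6, 5]
  have h2 := (wedge (wedge γ (fluxForm B 0 p)) (fluxForm B 1 p)).map_perm
    ![e 0 0, e 0 1, e 0 2, e 1 0, e 1 1, e 1 2, slotVec B p 2] τ
  have hτ : Equiv.Perm.sign τ = 1 := by decide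
  rw [hτ, one_smul] at h2
  rw [show Function.update (![e 0 0, e 0 1, e 0 2, e 1 0, e 1 1, e 1 2, e 2 0, e 2 1, e 2 2] ∘
    Fin.castAdd 2) (6 : Fin 7) (slotVec B p 2) =
      ![e 0 0, e 0 1, e 0 2, e 1 0, e 1 1, e 1 2, slotVec B p 2] by
    ext1 a; fin_cases a <;> rfl]
  rw [← h2]
  rw [show ![e 0 0, e 0 1, e 0 2, e 1 0, e 1 1, e 1 2, slotVec B p 2] ∘ τ =
    ![e 0 0, e 0 1, e 0 2, e 1 0, slotVec B p 2, e 1 1, e 1 2] by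
    ext1 a; fin_cases a <;> rfl]
  have h3 := wedge_fluxForm_apply (wedge γ (fluxForm B 0 p)) B 1 p 3
    ![e 0 0, e 0 1, e 0 2, e 1 0, slotVec B p 2, e 1 1, e 1 2] rfl rfl rfl
    (by intro j hj; fin_cases j <;> first | rfl | exact absurd rfl hj)
  rw [h3]
  rw [show Function.update (![e 0 0, e 0 1, e 0 2, e 1 0, slotVec B p 2, e 1 1, e 1 2] ∘
    Fin.castAdd 2) (3 : Fin 5) (slotVec B p 1) =
      ![e 0 0, e 0 1, e 0 2, slotVec B p 1, slotVec B p 2] by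
    ext1 a; fin_cases a <;> rfl]
  let τ' : Equiv.Perm (Fin 5) := Equiv.swap 1 3 * Equiv.swap 2 4
  have h4 := (wedge γ (fluxForm B 0 p)).map_perm
    ![e 0 0, e 0 1, e 0 2, slotVec B p 1, slotVec B p 2] τ'
  have hτ' : Equiv.Perm.sign τ' = 1 := by decide
  rw [hτ', one_smul] at h4
  rw [← h4]
  rw [show ![e 0 0, e 0 1, e 0 2, slotVec B p 1, slotVec B p 2] ∘ τ' =
    ![e 0 0, slotVec B p 1, slotVec B p 2, e 0 1, e 0 2] by
    ext1 a; fin_cases a <;> rfl]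
  have h5 := wedge_fluxForm_apply γ B 0 p 0
    ![e 0 0, slotVec B p 1, slotVec B p 2, e 0 1, e 0 2] rfl rfl rfl
    (by intro j hj; fin_cases j <;> first | rfl | exact absurd rfl hj)
  rw [h5]
  rw [show Function.update (![e 0 0, slotVec B p 1, slotVec B p 2, e 0 1, e 0 2] ∘
    Fin.castAdd 2) (0 : Fin 3) (slotVec B p 0) =
      ![slotVec B p 0, slotVec B p 1, slotVec B p 2] by
    ext1 a; fin_cases a <;> rfl]

theorem density_helicityForm (B : VField) (α : Amb → Amb [⋀^Fin 1]→L[ℝ] ℝ) (p : Fin 3 → S3) :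
    density (helicityForm B α) p =
      α (incl p) ![slotVec B p 0] * extDeriv α (incl p) ![slotVec B p 1, slotVec B p 2]
      - α (incl p) ![slotVec B p 1] * extDeriv α (incl p) ![slotVec B p 0, slotVec B p 2]
      + α (incl p) ![slotVec B p 2] * extDeriv α (incl p) ![slotVec B p 0, slotVec B p 1] := by
  rw [density, helicityForm, wedge_fluxForms_frame]
  have h := wedge_two_apply (α (incl p)).toAlternatingMap (extDeriv α (incl p)).toAlternatingMap 0
    ![slotVec B p 0, slotVec B p 1, slotVec B p 2] (fun i hi => absurd (Subsingleton.elim i 0) hi)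
  rw [h]
  have hs := (extDeriv α (incl p)).toAlternatingMap.map_swap
    ![slotVec B p 0, slotVec B p 1] (i := 0) (j := 1) (by decide)
  have e1 : ![slotVec B p 0, slotVec B p 1] ∘ Equiv.swap (0 : Fin 2) 1 =
      ![slotVec B p 1, slotVec B p 0] := by
    ext1 j; fin_cases j <;> rfl
  rw [e1] at hs
  have e2 : ∀ u w : Amb, Function.update (![slotVec B p 0, u, w] ∘ Fin.castAdd 2) (0 : Fin 1) u = ![u] := by
    intro u w; ext1 j; fin_cases j; rfl
  have e3 : ![slotVec B p 0, slotVec B p 1, slotVec B p 2] ∘ Fin.castAdd 2 = ![slotVec B p 0] := by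
    ext1 j; fin_cases j; rfl
  have e4 : ∀ u, Function.update ![slotVec B p 0] (0 : Fin 1) u = ![u] := by
    intro u; ext1 j; fin_cases j; rfl
  erw [e3, e4, e4]
  change _ - _ - _ * (extDeriv α (incl p)).toAlternatingMap ![slotVec B p 1, slotVec B p 0] = _
  rw [hs]
  show α (incl p) ![slotVec B p 0] * extDeriv α (incl p) ![slotVec B p 1, slotVec B p 2]
      - α (incl p) ![slotVec B p 1] * extDeriv α (incl p) ![slotVec B p 0, slotVec B p 2]
      - α (incl p) ![slotVec B p 2] * -extDeriv α (incl p) ![slotVec B p 0, slotVec B p 1] = _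
  ring

end Density

/-! ### Radial retraction and calculus on the sphere in ambient coordinates -/

section Retraction

open Classical in
/-- The radial retraction `q ↦ q / ‖q‖` of `ℍ ∖ {0}` onto `S³`. -/
def retr (q : ℍ[ℝ]) : S3 :=
  if h : q = 0 then ⟨1, by simp⟩ else ⟨‖q‖⁻¹ • q, by simp [norm_smul, h]⟩

theorem coe_retr {q : ℍ[ℝ]} (h : q ≠ 0) : (retr q : ℍ[ℝ]) = ‖q‖⁻¹ • q := by
  simp [retr, h]

theorem coe_S3_ne_zero (x : S3) : (x : ℍ[ℝ]) ≠ 0 := ne_zero_of_mem_unit_sphere x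

@[simp] theorem retr_coe (x : S3) : retr (x : ℍ[ℝ]) = x := by
  apply Subtype.ext
  rw [coe_retr (coe_S3_ne_zero x)]
  simp

theorem contMDiffAt_retr {q : ℍ[ℝ]} (hq : q ≠ 0) :
    ContMDiffAt 𝓘(ℝ, ℍ[ℝ]) (𝓡 3) ∞ retr q := by
  let U : TopologicalSpace.Opens ℍ[ℝ] := ⟨{0}ᶜ, isOpen_compl_singleton⟩
  have hU : ∀ u : U, (u : ℍ[ℝ]) ≠ 0 := fun u => u.2
  have h1 : ContMDiff 𝓘(ℝ, ℍ[ℝ]) 𝓘(ℝ, ℍ[ℝ]) ∞ (fun u : U => ‖(u : ℍ[ℝ])‖⁻¹ • (u : ℍ[ℝ])) := by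
    intro u
    have : ContDiffAt ℝ ∞ (fun q : ℍ[ℝ] => ‖q‖⁻¹ • q) u :=
      ((contDiffAt_norm ℝ (hU u)).inv (norm_ne_zero_iff.2 (hU u))).smul contDiffAt_id
    exact this.contMDiffAt.comp u (contMDiff_subtype_val u)
  have h2 := h1.codRestrict_sphere (n := 3) (fun u => by simp [norm_smul, hU u])
  have h3 := h2 ⟨q, hq⟩
  have : Set.codRestrict (fun u : U => ‖(u : ℍ[ℝ])‖⁻¹ • (u : ℍ[ℝ])) (Metric.sphere 0 1)
      (fun u => by simp [norm_smul, hU u]) = fun u : U => retr u := by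
    ext1 u
    apply Subtype.ext
    rw [coe_retr (hU u)]; rfl
  rw [this] at h3
  exact (contMDiffAt_subtype_iff (U := U) (f := retr)).1 h3

variable {E : Type*} [NormedAddCommGroup E] [NormedSpace ℝ E]

theorem contDiffAt_comp_retr {f : S3 → E} {q : ℍ[ℝ]} (hq : q ≠ 0)
    (hf : ContMDiffAt (𝓡 3) 𝓘(ℝ, E) ∞ f (retr q)) : ContDiffAt ℝ ∞ (fun q => f (retr q)) q :=
  (hf.comp q (contMDiffAt_retr hq)).contDiffAt

theorem contMDiff_coe_S3 : ContMDiff (𝓡 3) 𝓘(ℝ, ℍ[ℝ]) ∞ (fun y : S3 => (y : ℍ[ℝ])) :=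
  contMDiff_coe_sphere

/-- Chain rule for `f = (f ∘ retr) ∘ coe`. It turns derivatives on the sphere into ordinary
derivatives in the quaternions. -/
theorem mfderiv_eq_fderiv_comp_retr {f : S3 → E} {x : S3}
    (hf : ContMDiffAt (𝓡 3) 𝓘(ℝ, E) ∞ f x) (w : TangentSpace (𝓡 3) x) :
    mfderiv (𝓡 3) 𝓘(ℝ, E) f x w =
      fderiv ℝ (fun q => f (retr q)) x
        (mfderiv (𝓡 3) 𝓘(ℝ, ℍ[ℝ]) (fun y : S3 => (y : ℍ[ℝ])) x w) := by
  have h1 : ContDiffAt ℝ ∞ (fun q => f (retr q)) (x : ℍ[ℝ]) :=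
    contDiffAt_comp_retr (coe_S3_ne_zero x) (by rwa [retr_coe])
  have h2 : MDifferentiableAt 𝓘(ℝ, ℍ[ℝ]) 𝓘(ℝ, E) (fun q => f (retr q)) (x : ℍ[ℝ]) :=
    (h1.differentiableAt (by simp)).mdifferentiableAt
  have h3 : MDifferentiableAt (𝓡 3) 𝓘(ℝ, ℍ[ℝ]) (fun y : S3 => (y : ℍ[ℝ])) x :=
    (contMDiff_coe_S3 x).mdifferentiableAt (by simp)
  have h4 := mfderiv_comp x h2 h3
  have h5 : (fun q => f (retr q)) ∘ (fun y : S3 => (y : ℍ[ℝ])) = f := by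
    ext1 y; simp
  rw [h5, mfderiv_eq_fderiv] at h4
  rw [h4]
  rfl

theorem contMDiff_ambVec {B : VField} (hB : IsSVect B) :
    ContMDiff (𝓡 3) 𝓘(ℝ, ℍ[ℝ]) ∞ (ambVec B) := by
  have h1 : ContMDiff (𝓡 3).tangent 𝓘(ℝ, ℍ[ℝ]).tangent ∞
      (tangentMap (𝓡 3) 𝓘(ℝ, ℍ[ℝ]) (fun y : S3 => (y : ℍ[ℝ]))) :=
    contMDiff_coe_S3.contMDiff_tangentMap (by simp)
  exact (contMDiff_snd_tangentBundle_modelSpace ℍ[ℝ] 𝓘(ℝ, ℍ[ℝ])).comp (h1.comp hB.smooth)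

theorem hasDerivAt_comp_of_hasMFDerivAt {γ : ℝ → S3} {t : ℝ} {w : TangentSpace (𝓡 3) (γ t)}
    (hγ : HasMFDerivAt 𝓘(ℝ, ℝ) (𝓡 3) γ t ((1 : ℝ →L[ℝ] ℝ).smulRight w)) {f : S3 → E}
    (hf : MDifferentiableAt (𝓡 3) 𝓘(ℝ, E) f (γ t)) :
    HasDerivAt (fun s => f (γ s)) (mfderiv (𝓡 3) 𝓘(ℝ, E) f (γ t) w) t := by
  let L : ℝ →L[ℝ] E := (mfderiv (𝓡 3) 𝓘(ℝ, E) f (γ t)).comp ((1 : ℝ →L[ℝ] ℝ).smulRight w)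
  have h : HasFDerivAt (fun s => f (γ s)) L t := (hf.hasMFDerivAt.comp t hγ).hasFDerivAt
  have e : L 1 = mfderiv (𝓡 3) 𝓘(ℝ, E) f (γ t) w :=
    congrArg (mfderiv (𝓡 3) 𝓘(ℝ, E) f (γ t)) (one_smul ℝ w)
  have h' := h.hasDerivAt
  rw [e] at h'
  exact h'

theorem hasDerivAt_coe_integralCurve {B : VField} {γ : ℝ → S3}
    (hγ : IsMIntegralCurve (I := 𝓡 3) γ B) (t : ℝ) :
    HasDerivAt (fun s => (γ s : ℍ[ℝ])) (ambVec B (γ t)) t :=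
  hasDerivAt_comp_of_hasMFDerivAt (hγ t) ((contMDiff_coe_S3 (γ t)).mdifferentiableAt (by simp))

end Retraction

/-! ### Hadamard-type bound and Grönwall argument -/

section LocalBound

/-- A function that vanishes on the regular zero set of `F` is locally bounded by a multiple of
`F`. -/
theorem exists_eventually_abs_le_mul_abs {E : Type*} [NormedAddCommGroup E] [NormedSpace ℝ E]
    {F h : E → ℝ} {x : E} (hF : ContDiffAt ℝ 1 F x) (hh : ContDiffAt ℝ 1 h x) (hFx : F x = 0)
    (hdF : fderiv ℝ F x ≠ 0) (hz : ∀ᶠ q in 𝓝 x, F q = 0 → h q = 0) :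
    ∃ C : ℝ, ∀ᶠ q in 𝓝 x, |h q| ≤ C * |F q| := by
  obtain ⟨e, he⟩ : ∃ e, fderiv ℝ F x e = 1 := by
    obtain ⟨e, he⟩ : ∃ e, fderiv ℝ F x e ≠ 0 := by
      by_contra! hcon
      exact hdF (ContinuousLinearMap.ext hcon)
    exact ⟨(fderiv ℝ F x e)⁻¹ • e, by simp [he]⟩
  obtain ⟨K, t, ht, hKt⟩ := hh.exists_lipschitzOnWith
  obtain ⟨K', t', ht', hKt'⟩ := hF.exists_lipschitzOnWith
  have hstrict := hF.hasStrictFDerivAt (by simp)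
  have hM : 0 < ‖e‖ + 1 := by positivity
  -- With this constant the linearisation error of `F` along `s • e` is at most `|s| / 2`. The
  -- summand `1` only keeps the denominator positive.
  have hlo := hstrict.isLittleO.def (c := (2 * (‖e‖ + 1))⁻¹) (by positivity)
  rw [nhds_prod_eq, eventually_prod_self_iff'] at hlo
  obtain ⟨t'', ht'', hlo⟩ := hlo
  obtain ⟨δ, hδ, hball⟩ := Metric.mem_nhds_iff.1 (inter_mem (inter_mem ht ht') (inter_mem ht'' hz))
  have hsmall : ∀ᶠ q in 𝓝 x, |F q| < δ / (4 * (‖e‖ + 1)) := by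
    have : Tendsto (fun q => |F q|) (𝓝 x) (𝓝 |F x|) := hF.continuousAt.abs
    rw [hFx, abs_zero] at this
    exact this.eventually_lt_const (by positivity)
  refine ⟨K * (2 * ‖e‖), ?_⟩
  filter_upwards [hsmall, Metric.ball_mem_nhds x (half_pos hδ)] with q hq hqx
  -- Along `e` the change of `F` over a step `s` differs from `s` by at most `|s| / 2`, so `F` has a
  -- zero within parameter distance `2 * |F q|` of `q`. There `h` vanishes too, and the Lipschitz
  -- bound for `h` gives the estimate.
  set ρ := 2 * |F q| with hρ
  have hρ0 : 0 ≤ ρ := by positivity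
  have hρM : ρ * (‖e‖ + 1) < δ / 2 := by
    rw [lt_div_iff₀ (by positivity)] at hq
    rw [hρ]; linarith
  have hmem : ∀ s : ℝ, |s| ≤ ρ → q + s • e ∈ Metric.ball x δ := by
    intro s hs
    rw [Metric.mem_ball, dist_eq_norm] at hqx ⊢
    calc ‖q + s • e - x‖ = ‖(q - x) + s • e‖ := by congr 1; abel
      _ ≤ ‖q - x‖ + |s| * ‖e‖ := (norm_add_le _ _).trans (by rw [norm_smul, Real.norm_eq_abs])
      _ ≤ ‖q - x‖ + ρ * (‖e‖ + 1) := by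
        gcongr; linarith
      _ < δ := by linarith
  have hq0 : q ∈ Metric.ball x δ := by simpa using hmem 0 (by simpa using hρ0)
  have happ : ∀ s : ℝ, |s| ≤ ρ → |F (q + s • e) - F q - s| ≤ |s| / 2 := by
    intro s hs
    have := hlo (q + s • e) (hball (hmem s hs)).2.1 q (hball hq0).2.1
    simp only [add_sub_cancel_left, map_smul, he, smul_eq_mul, mul_one, Real.norm_eq_abs,
      norm_smul] at this
    refine this.trans ?_
    rw [mul_inv, mul_assoc, mul_comm |s|, ← mul_assoc _ ‖e‖]
    have : (‖e‖ + 1)⁻¹ * ‖e‖ ≤ 1 := by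
      rw [inv_mul_le_iff₀ hM]; linarith
    nlinarith [abs_nonneg s]
  have hcont : ContinuousOn (fun s : ℝ => F (q + s • e)) (Set.Icc (-ρ) ρ) := by
    refine hKt'.continuousOn.comp (by fun_prop) ?_
    intro s hs
    exact (hball (hmem s (abs_le.2 hs))).1.2
  have hIVT := intermediate_value_Icc (by linarith) hcont
  have h1 := abs_le.1 (happ ρ (abs_of_nonneg hρ0).le)
  have h2 := abs_le.1 (happ (-ρ) (by rw [abs_neg]; exact (abs_of_nonneg hρ0).le))
  rw [abs_neg, abs_of_nonneg hρ0] at h2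
  rw [abs_of_nonneg hρ0] at h1
  have h3 := abs_le.1 (le_refl |F q|)
  obtain ⟨s, hs, hs0⟩ := hIVT (show (0 : ℝ) ∈ Set.Icc _ _ from ⟨by linarith, by linarith⟩)
  have hsρ := abs_le.2 hs
  have hh0 : h (q + s • e) = 0 := (hball (hmem s hsρ)).2.2 hs0
  have := hKt.dist_le_mul q (hball hq0).1.1 (q + s • e) (hball (hmem s hsρ)).1.1
  rw [hh0, Real.dist_eq, sub_zero, dist_eq_norm] at this
  refine this.trans ?_
  have e1 : ‖q - (q + s • e)‖ = |s| * ‖e‖ := by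
    rw [sub_add_cancel_left, norm_neg, norm_smul, Real.norm_eq_abs]
  rw [e1]
  have : |s| * ‖e‖ ≤ ρ * ‖e‖ := by gcongr
  calc (K : ℝ) * (|s| * ‖e‖) ≤ K * (ρ * ‖e‖) := by gcongr
    _ = K * (2 * ‖e‖) * |F q| := by rw [hρ]; ring

/-- Grönwall's inequality, applied forwards and, by the reflection `σ = -1`, backwards in time. -/
theorem eventually_eq_zero_of_abs_deriv_le {u u' : ℝ → ℝ} {t₀ C : ℝ}
    (hu : ∀ᶠ t in 𝓝 t₀, HasDerivAt u (u' t) t ∧ |u' t| ≤ C * |u t|) (h0 : u t₀ = 0) :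
    ∀ᶠ t in 𝓝 t₀, u t = 0 := by
  obtain ⟨δ, hδ, hball⟩ := Metric.eventually_nhds_iff_ball.1 hu
  have key : ∀ σ : ℝ, |σ| = 1 → ∀ s ∈ Set.Icc 0 (δ / 2), u (t₀ + σ * s) = 0 := by
    intro σ hσ
    have hm : ∀ s ∈ Set.Icc 0 (δ / 2), t₀ + σ * s ∈ Metric.ball t₀ δ := by
      intro s hs
      rw [Metric.mem_ball, Real.dist_eq, add_sub_cancel_left, abs_mul, hσ, one_mul,
        abs_of_nonneg hs.1]
      linarith [hs.2]
    have hd : ∀ s ∈ Set.Icc 0 (δ / 2),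
        HasDerivAt (fun s => u (t₀ + σ * s)) (u' (t₀ + σ * s) * σ) s := by
      intro s hs
      have h1 : HasDerivAt (fun s => t₀ + σ * s) σ s := by
        simpa using ((hasDerivAt_id s).const_mul σ).const_add t₀
      exact (hball _ (hm s hs)).1.comp s h1
    refine eq_zero_of_abs_deriv_le_mul_abs_self_of_eq_zero_right (K := C)
      (f' := fun s => u' (t₀ + σ * s) * σ)
      (fun s hs => (hd s hs).continuousAt.continuousWithinAt)
      (fun s hs => (hd s (Set.Ico_subset_Icc_self hs)).hasDerivWithinAt) (by simpa using h0) ?_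
    intro s hs
    rw [Real.norm_eq_abs, Real.norm_eq_abs, abs_mul, hσ, mul_one]
    exact (hball _ (hm s (Set.Ico_subset_Icc_self hs))).2
  filter_upwards [Metric.ball_mem_nhds t₀ (half_pos hδ)] with t ht
  rw [Metric.mem_ball, Real.dist_eq] at ht
  rcases le_total 0 (t - t₀) with h | h
  · have := key 1 (by simp) (t - t₀) ⟨h, by rw [abs_of_nonneg h] at ht; exact ht.le⟩
    simpa using this
  · have := key (-1) (by simp) (-(t - t₀)) ⟨by linarith, by rw [abs_of_nonpos h] at ht; exact ht.le⟩
    simpa using this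

end LocalBound

/-! ### Invariance of a domain under a flow tangent to its boundary -/

section Invariance

theorem fderiv_comp_retr_ne_zero_iff {f : S3 → ℝ} {x : S3}
    (hf : ContMDiffAt (𝓡 3) 𝓘(ℝ, ℝ) ∞ f x) :
    fderiv ℝ (fun q => f (retr q)) (x : ℍ[ℝ]) ≠ 0 ↔ mfderiv (𝓡 3) 𝓘(ℝ, ℝ) f x ≠ 0 := by
  rw [not_iff_not]
  constructor
  · intro h
    ext w
    rw [mfderiv_eq_fderiv_comp_retr hf, h]
    rfl
  · intro h
    have h1 : MDifferentiableAt 𝓘(ℝ, ℍ[ℝ]) (𝓡 3) retr (x : ℍ[ℝ]) :=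
      (contMDiffAt_retr (coe_S3_ne_zero x)).mdifferentiableAt (by simp)
    have h2 : MDifferentiableAt (𝓡 3) 𝓘(ℝ, ℝ) f (retr (x : ℍ[ℝ])) := by
      rw [retr_coe]; exact hf.mdifferentiableAt (by simp)
    have h3 := mfderiv_comp (x : ℍ[ℝ]) h2 h1
    rw [mfderiv_eq_fderiv] at h3
    change fderiv ℝ (f ∘ retr) (x : ℍ[ℝ]) = 0
    rw [h3]
    have h4 : mfderiv (𝓡 3) 𝓘(ℝ, ℝ) f (retr (x : ℍ[ℝ])) = 0 := by
      rw [retr_coe]; exact h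
    rw [h4]
    ext w
    rfl

/-- At an interior point of `T` a zero of `f` would be a local maximum, against `df ≠ 0`. Thus
tangency, which is assumed only on the frontier, holds at all regular zeros of `f` near a boundary
point. -/
theorem mem_frontier_of_apply_eq_zero {T U : Set S3} {f : S3 → ℝ} {y : S3} (hU : IsOpen U)
    (hy : y ∈ U) (hf : ContMDiffOn (𝓡 3) 𝓘(ℝ, ℝ) ∞ f U) (hfy : f y = 0)
    (hdf : mfderiv (𝓡 3) 𝓘(ℝ, ℝ) f y ≠ 0) (hT : ∀ y ∈ U, y ∈ T ↔ f y ≤ 0) : y ∈ frontier T := by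
  refine ⟨subset_closure ((hT y hy).2 hfy.le), fun hint => ?_⟩
  have hfy' := (hf.contMDiffAt (hU.mem_nhds hy))
  rw [← fderiv_comp_retr_ne_zero_iff hfy'] at hdf
  apply hdf
  apply IsLocalMax.fderiv_eq_zero
  have hc : Tendsto retr (𝓝 (y : ℍ[ℝ])) (𝓝 y) := by
    simpa using (contMDiffAt_retr (coe_S3_ne_zero y)).continuousAt.tendsto
  filter_upwards [hc.eventually (hU.mem_nhds hy), hc.eventually (mem_interior_iff_mem_nhds.1 hint)]
    with q hq hqT
  simpa [hfy] using (hT _ hq).1 hqT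

/-- The set of times with `γ t ∈ T` is closed, and it is open at times where `γ` is in the interior.
At a boundary point, tangency makes the derivative of `f` along `B` vanish on `f = 0`, so it is
bounded by `C * |f|` nearby. By Grönwall `f ∘ γ` then vanishes for nearby times, so the set is open
and is all of `ℝ`. -/
theorem IsSVect.mem_of_integralCurve {B : VField} (hB : IsSVect B) {T : Set S3} (hT : IsClosed T)
    (hbd : ∀ x ∈ frontier T, ∃ (U : Set S3) (f : S3 → ℝ), IsBoundaryDefining T x U f)
    (htan : IsTangentToBoundary B T) {γ : ℝ → S3} (hγ : IsMIntegralCurve (I := 𝓡 3) γ B)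
    (h0 : γ 0 ∈ T) (t : ℝ) : γ t ∈ T := by
  have hγc : Continuous γ := hγ.continuous
  have hclopen : IsClopen (γ ⁻¹' T) := by
    refine ⟨hT.preimage hγc, isOpen_iff_mem_nhds.2 fun t₀ ht₀ => ?_⟩
    by_cases hint : γ t₀ ∈ interior T
    · exact hγc.continuousAt (mem_interior_iff_mem_nhds.1 hint)
    have hfr : γ t₀ ∈ frontier T := ⟨subset_closure ht₀, hint⟩
    obtain ⟨U, f, hf⟩ := hbd _ hfr
    set x := γ t₀ with hx
    have hfU : ∀ y ∈ U, ContMDiffAt (𝓡 3) 𝓘(ℝ, ℝ) ∞ f y := fun y hy =>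
      hf.smooth.contMDiffAt (hf.isOpen.mem_nhds hy)
    set F : ℍ[ℝ] → ℝ := fun q => f (retr q) with hFdef
    let h : ℍ[ℝ] → ℝ := fun q => fderiv ℝ F (retr q : ℍ[ℝ]) (ambVec B (retr q))
    have hFU : ∀ y ∈ U, ContDiffAt ℝ ∞ F (y : ℍ[ℝ]) := fun y hy =>
      contDiffAt_comp_retr (coe_S3_ne_zero y) (by rw [retr_coe]; exact hfU y hy)
    have hretr : Tendsto retr (𝓝 (x : ℍ[ℝ])) (𝓝 x) := by
      simpa using (contMDiffAt_retr (coe_S3_ne_zero x)).continuousAt.tendsto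
    have hdF : ContDiffAt ℝ ∞ (fderiv ℝ F) (x : ℍ[ℝ]) :=
      (hFU x hf.mem).fderiv_right (m := ∞) (by simp)
    have hcr : ContDiffAt ℝ ∞ (fun q => (retr q : ℍ[ℝ])) (x : ℍ[ℝ]) :=
      contDiffAt_comp_retr (coe_S3_ne_zero x) (contMDiff_coe_S3 _)
    have hhC : ContDiffAt ℝ ∞ h (x : ℍ[ℝ]) := by
      refine ContDiffAt.clm_apply ?_
        (contDiffAt_comp_retr (coe_S3_ne_zero x) (contMDiff_ambVec hB _))
      refine ContDiffAt.comp (x : ℍ[ℝ]) ?_ hcr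
      rwa [retr_coe]
    have hne : ∀ᶠ y : S3 in 𝓝 x, fderiv ℝ F (y : ℍ[ℝ]) ≠ 0 := by
      have hc : ContinuousAt (fun y : S3 => fderiv ℝ F (y : ℍ[ℝ])) x :=
        ContinuousAt.comp (f := fun y : S3 => (y : ℍ[ℝ])) hdF.continuousAt
          continuous_subtype_val.continuousAt
      exact hc.eventually_ne ((fderiv_comp_retr_ne_zero_iff (hfU x hf.mem)).2 hf.mfderiv_ne_zero)
    have hz : ∀ᶠ q in 𝓝 (x : ℍ[ℝ]), F q = 0 → h q = 0 := by
      filter_upwards [hretr.eventually (hf.isOpen.mem_nhds hf.mem), hretr.eventually hne]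
        with q hqU hq hFq
      have hd := (fderiv_comp_retr_ne_zero_iff (hfU _ hqU)).1 hq
      have hfr' : retr q ∈ frontier T :=
        mem_frontier_of_apply_eq_zero hf.isOpen hqU hf.smooth hFq hd hf.mem_iff
      have := htan _ hfr' U f ⟨hf.isOpen, hqU, hf.smooth, hFq, hd, hf.mem_iff⟩
      rw [mfderiv_eq_fderiv_comp_retr (hfU _ hqU)] at this
      exact this
    obtain ⟨C, hC⟩ := exists_eventually_abs_le_mul_abs ((hFU x hf.mem).of_le (by simp))
      (hhC.of_le (by simp)) (by simp [F, hf.apply_eq_zero])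
      ((fderiv_comp_retr_ne_zero_iff (hfU x hf.mem)).2 hf.mfderiv_ne_zero) hz
    have hγx : Tendsto (fun t => (γ t : ℍ[ℝ])) (𝓝 t₀) (𝓝 (x : ℍ[ℝ])) :=
      (continuous_subtype_val.comp hγc).tendsto t₀
    have hγU : ∀ᶠ t in 𝓝 t₀, γ t ∈ U := hγc.continuousAt (hf.isOpen.mem_nhds hf.mem)
    have hzero : ∀ᶠ t in 𝓝 t₀, f (γ t) = 0 := by
      refine eventually_eq_zero_of_abs_deriv_le (u' := fun t => h (γ t)) (C := C) ?_
        hf.apply_eq_zero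
      filter_upwards [hγU, hγx.eventually hC] with t htU htC
      refine ⟨?_, by simpa [F] using htC⟩
      have := ((hFU _ htU).differentiableAt (by simp)).hasFDerivAt.comp_hasDerivAt t
        (hasDerivAt_coe_integralCurve hγ t)
      simpa [F, h, Function.comp_def] using this
    filter_upwards [hγU, hzero] with t htU ht
    exact (hf.mem_iff _ htU).2 ht.le
  have := hclopen.eq_univ ⟨0, h0⟩
  exact (Set.ext_iff.1 this t).2 (Set.mem_univ t)

end Invariance

/-! ### Finiteness and compactness -/

section Measure

instance instIsFiniteMeasureVol : IsFiniteMeasure vol := by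
  unfold vol; infer_instance

instance instIsFiniteMeasureVol3 : IsFiniteMeasure vol3 := by
  unfold vol3; infer_instance

theorem isCompact_handlebodyModel (n : ℕ) : IsCompact (handlebodyModel n) := by
  refine IsCompact.prod ?_ isCompact_Icc
  refine (isCompact_closedBall _ _).diff ?_
  exact isOpen_biUnion fun _ _ => Metric.isOpen_ball

theorem IsHandlebody.isCompact {T : Set S3} (hT : IsHandlebody T) : IsCompact T := by
  obtain ⟨n, ⟨e⟩⟩ := hT.model
  rw [isCompact_iff_compactSpace]
  have := isCompact_iff_compactSpace.1 (isCompact_handlebodyModel n)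
  exact e.symm.compactSpace

theorem isCompact_prodDomain {T : Fin 3 → Set S3} (hT : ∀ i, IsHandlebody (T i)) :
    IsCompact (prodDomain T) :=
  isCompact_univ_pi fun i => (hT i).isCompact

theorem continuous_incl : Continuous incl := by
  unfold incl; fun_prop

end Measure

/-! ### Integration by parts along the flow in one factor -/

section IntegrationByParts

/-- The coordinatewise flow in the `i`-th factor. -/
def slotFlow (Φ : ℝ → S3 → S3) (i : Fin 3) (t : ℝ) (p : Fin 3 → S3) : Fin 3 → S3 :=
  fun j => (if j = i then Φ t else id) (p j)

variable {B : VField} {T : Fin 3 → Set S3}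

theorem continuous_slotVec (hB : IsSVect B) (i : Fin 3) : Continuous fun p => slotVec B p i := by
  unfold slotVec
  exact (continuous_single i).comp ((contMDiff_ambVec hB).continuous.comp (continuous_apply i))

theorem mapsTo_slotFlow {Φ : ℝ → S3 → S3} {i : Fin 3} {t : ℝ} (h : Set.MapsTo (Φ t) (T i) (T i)) :
    Set.MapsTo (slotFlow Φ i t) (prodDomain T) (prodDomain T) := by
  intro p hp j _
  by_cases hj : j = i
  · subst hj
    simpa [slotFlow] using h (hp j trivial)
  · simpa [slotFlow, hj] using hp j trivial

/-- Forward invariance suffices: the product domain lies in its preimage, which has the same finite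
measure, so the two agree almost everywhere. -/
theorem measurePreserving_slotFlow {Φ : ℝ → S3 → S3} {i : Fin 3} {t : ℝ}
    (hΦ : MeasurePreserving (Φ t) vol vol) (h : Set.MapsTo (Φ t) (T i) (T i))
    (hT : ∀ i, IsHandlebody (T i)) :
    MeasurePreserving (slotFlow Φ i t) (vol3.restrict (prodDomain T))
      (vol3.restrict (prodDomain T)) := by
  have h1 : MeasurePreserving (slotFlow Φ i t) vol3 vol3 := by
    refine measurePreserving_pi _ _ fun j => ?_
    by_cases hj : j = i
    · simpa [hj] using hΦ
    · simpa [hj] using MeasurePreserving.id vol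
  have hm : MeasurableSet (prodDomain T) := (isCompact_prodDomain hT).isClosed.measurableSet
  have h2 := h1.restrict_preimage hm
  have h3 : prodDomain T =ᵐ[vol3] slotFlow Φ i t ⁻¹' prodDomain T := by
    refine ae_eq_of_subset_of_measure_ge (mapsTo_slotFlow h) ?_ hm.nullMeasurableSet
      (measure_ne_top _ _)
    rw [h1.measure_preimage hm.nullMeasurableSet]
  rwa [Measure.restrict_congr_set h3.symm] at h2

theorem hasDerivAt_incl_slotFlow {Φ : ℝ → S3 → S3}
    (hΦ : ∀ x, IsMIntegralCurve (I := 𝓡 3) (fun t => Φ t x) B) (i : Fin 3) (t : ℝ)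
    (p : Fin 3 → S3) :
    HasDerivAt (fun s => incl (slotFlow Φ i s p)) (slotVec B (slotFlow Φ i t p) i) t := by
  rw [hasDerivAt_pi]
  intro j
  by_cases hj : j = i
  · subst hj
    simpa [incl, slotFlow, slotVec] using hasDerivAt_coe_integralCurve (hΦ (p j)) t
  · simpa [incl, slotFlow, slotVec, hj] using hasDerivAt_const t (p j : ℍ[ℝ])

theorem integrableOn_of_continuousOn_prodDomain (hT : ∀ i, IsHandlebody (T i))
    {f : (Fin 3 → S3) → ℝ} (hf : ContinuousOn f (prodDomain T)) :
    IntegrableOn f (prodDomain T) vol3 :=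
  hf.integrableOn_compact (isCompact_prodDomain hT)

variable {E : Type*} [NormedAddCommGroup E] [NormedSpace ℝ E]

theorem continuousOn_comp_incl {f : Amb → E}
    (hf : ∀ p ∈ prodDomain T, ContDiffAt ℝ ∞ f (incl p)) :
    ContinuousOn (fun p => f (incl p)) (prodDomain T) := fun p hp =>
  (ContinuousAt.comp (f := incl) (hf p hp).continuousAt
    continuous_incl.continuousAt).continuousWithinAt

theorem contDiffAt_fderiv {F : Type*} [NormedAddCommGroup F] [NormedSpace ℝ F] {f : F → E} {x : F}
    (hf : ContDiffAt ℝ ∞ f x) : ContDiffAt ℝ ∞ (fderiv ℝ f) x :=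
  hf.fderiv_right (m := ∞) (by simp)

theorem continuousOn_fderiv_slotVec (hB : IsSVect B) {f : Amb → E}
    (hf : ∀ p ∈ prodDomain T, ContDiffAt ℝ ∞ f (incl p)) (i : Fin 3) :
    ContinuousOn (fun p => fderiv ℝ f (incl p) (slotVec B p i)) (prodDomain T) :=
  (continuousOn_comp_incl fun p hp => contDiffAt_fderiv (hf p hp)).clm_apply
    (continuous_slotVec hB i).continuousOn

/-- The derivative of a function in the direction of an invariant volume-preserving vector field
has integral zero. -/
theorem integral_fderiv_slotVec (hB : IsSVect B) (hT : ∀ i, IsHandlebody (T i))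
    (htan : ∀ i, IsTangentToBoundary B (T i)) {f : Amb → ℝ}
    (hf : ∀ p ∈ prodDomain T, ContDiffAt ℝ ∞ f (incl p)) (i : Fin 3) :
    ∫ p in prodDomain T, fderiv ℝ f (incl p) (slotVec B p i) ∂vol3 = 0 := by
  obtain ⟨Φ, hΦ0, hΦ, hΦm⟩ := hB.flow
  have hmaps : ∀ t, Set.MapsTo (Φ t) (T i) (T i) := fun t x hx =>
    hB.mem_of_integralCurve (hT i).isCompact.isClosed (hT i).smooth_boundary (htan i) (hΦ x)
      (by simpa [hΦ0] using hx) t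
  have hmp := fun t => measurePreserving_slotFlow (hΦm t) (hmaps t) hT
  have hm : MeasurableSet (prodDomain T) := (isCompact_prodDomain hT).isClosed.measurableSet
  have hfc := continuousOn_comp_incl hf
  have hdc := continuousOn_fderiv_slotVec hB hf i
  obtain ⟨C, hC⟩ := (isCompact_prodDomain hT).exists_bound_of_continuousOn hdc
  -- The integral of `f` composed with the flow is differentiated under the integral sign. By
  -- invariance of the measure it is constant in `t`, so its derivative at `0`, which is the
  -- integral in question, vanishes.
  have hder := hasDerivAt_integral_of_dominated_loc_of_deriv_le
    (μ := vol3.restrict (prodDomain T)) (bound := fun _ => C) (s := Set.univ) (x₀ := (0 : ℝ))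
    (F := fun t p => f (incl (slotFlow Φ i t p)))
    (F' := fun t p => fderiv ℝ f (incl (slotFlow Φ i t p)) (slotVec B (slotFlow Φ i t p) i))
    univ_mem
    (Eventually.of_forall fun t =>
      (hfc.aestronglyMeasurable hm).comp_measurePreserving (hmp t))
    ((hmp 0).integrable_comp_of_integrable (integrableOn_of_continuousOn_prodDomain hT hfc))
    ((hdc.aestronglyMeasurable hm).comp_measurePreserving (hmp 0))
    (by
      refine (ae_restrict_iff' hm).2 (Eventually.of_forall fun p hp t _ => ?_)
      exact hC _ (mapsTo_slotFlow (hmaps t) hp))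
    (integrable_const C)
    (by
      refine (ae_restrict_iff' hm).2 (Eventually.of_forall fun p hp t _ => ?_)
      exact ((hf _ (mapsTo_slotFlow (hmaps t) hp)).differentiableAt
        (by simp)).hasFDerivAt.comp_hasDerivAt t (hasDerivAt_incl_slotFlow hΦ i t p))
  have hconst : (fun t : ℝ => ∫ p in prodDomain T, f (incl (slotFlow Φ i t p)) ∂vol3) =
      fun _ => ∫ p in prodDomain T, f (incl p) ∂vol3 := by
    ext t
    have h1 := integral_map (μ := vol3.restrict (prodDomain T)) (f := fun p => f (incl p))
      (hmp t).measurable.aemeasurable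
      (by rw [(hmp t).map_eq]; exact hfc.aestronglyMeasurable hm)
    rw [(hmp t).map_eq] at h1
    exact h1.symm
  have h0 := hder.2
  rw [hconst] at h0
  have h1 := h0.unique (hasDerivAt_const _ _)
  have hid : ∀ p, slotFlow Φ i 0 p = p := by
    intro p; ext1 j
    by_cases hj : j = i <;> simp [slotFlow, hj, hΦ0]
  simpa [hid] using h1

end IntegrationByParts

/-! ### Symmetry of $\int A\wedge dA'$ and independence of the potential -/

section OneForms

/-- The exterior derivative of a one-form, as a function of two vectors. -/
def extDerivOne {E : Type*} [NormedAddCommGroup E] [NormedSpace ℝ E] (A : E → E →L[ℝ] ℝ) (x u v : E) :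
    ℝ :=
  fderiv ℝ A x u v - fderiv ℝ A x v u

/-- The extension of `slotVec` to a vector field on a dense open set of the ambient space. -/
def slotField (B : VField) (i : Fin 3) (q : Amb) : Amb := Pi.single i (ambVec B (retr (q i)))

variable {B : VField} {T : Fin 3 → Set S3}

theorem slotField_incl (p : Fin 3 → S3) (i : Fin 3) : slotField B i (incl p) = slotVec B p i := by
  simp [slotField, slotVec, incl]

theorem contDiffAt_ambVec_retr (hB : IsSVect B) {q : ℍ[ℝ]} (hq : q ≠ 0) :
    ContDiffAt ℝ ∞ (fun q => ambVec B (retr q)) q :=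
  contDiffAt_comp_retr hq (contMDiff_ambVec hB _)

theorem hasFDerivAt_slotField (hB : IsSVect B) (p : Fin 3 → S3) (i : Fin 3) :
    HasFDerivAt (slotField B i)
      ((ContinuousLinearMap.single ℝ (fun _ : Fin 3 => ℍ[ℝ]) i).comp
        ((fderiv ℝ (fun q => ambVec B (retr q)) (p i : ℍ[ℝ])).comp
          (ContinuousLinearMap.proj i))) (incl p) := by
  have h1 : HasFDerivAt (fun q => ambVec B (retr q))
      (fderiv ℝ (fun q => ambVec B (retr q)) (p i : ℍ[ℝ])) (incl p i) :=
    ((contDiffAt_ambVec_retr hB (coe_S3_ne_zero (p i))).differentiableAt (by simp)).hasFDerivAt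
  have h2 := h1.comp (incl p)
    (ContinuousLinearMap.proj (R := ℝ) (φ := fun _ : Fin 3 => ℍ[ℝ]) i).hasFDerivAt
  exact (ContinuousLinearMap.single ℝ (fun _ : Fin 3 => ℍ[ℝ]) i).hasFDerivAt.comp (incl p) h2

theorem contDiffAt_slotField (hB : IsSVect B) (p : Fin 3 → S3) (i : Fin 3) :
    ContDiffAt ℝ ∞ (slotField B i) (incl p) := by
  have h1 : ContDiffAt ℝ ∞ (fun q => ambVec B (retr q)) (incl p i) :=
    contDiffAt_ambVec_retr hB (coe_S3_ne_zero (p i))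
  have h2 := h1.comp (incl p)
    (ContinuousLinearMap.proj (R := ℝ) (φ := fun _ : Fin 3 => ℍ[ℝ]) i).contDiff.contDiffAt
  exact (ContinuousLinearMap.single ℝ (fun _ : Fin 3 => ℍ[ℝ]) i).contDiff.contDiffAt.comp
    (incl p) h2

/-- The field in factor `j` does not depend on the coordinate in factor `i`, so no derivative of the
field appears. This is why no Lie bracket enters the formula for the exterior derivative. -/
theorem fderiv_apply_slotField (hB : IsSVect B) {A : Amb → Amb →L[ℝ] ℝ} {p : Fin 3 → S3}
    (hA : DifferentiableAt ℝ A (incl p)) {i j : Fin 3} (hij : i ≠ j) :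
    fderiv ℝ (fun q => A q (slotField B j q)) (incl p) (slotVec B p i) =
      fderiv ℝ A (incl p) (slotVec B p i) (slotVec B p j) := by
  rw [(hA.hasFDerivAt.clm_apply (hasFDerivAt_slotField hB p j)).fderiv]
  have h : slotVec B p i j = 0 := by simp [slotVec, hij.symm]
  simp [slotField_incl, h]

/-- The value of `A ∧ dA'` on `(B₁, B₂, B₃)`. -/
def wedgeSlots (B : VField) (A A' : Amb → Amb →L[ℝ] ℝ) (p : Fin 3 → S3) : ℝ :=
  A (incl p) (slotVec B p 0) * extDerivOne A' (incl p) (slotVec B p 1) (slotVec B p 2)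
  - A (incl p) (slotVec B p 1) * extDerivOne A' (incl p) (slotVec B p 0) (slotVec B p 2)
  + A (incl p) (slotVec B p 2) * extDerivOne A' (incl p) (slotVec B p 0) (slotVec B p 1)

theorem continuousOn_extDerivOne_slotVec (hB : IsSVect B) {A : Amb → Amb →L[ℝ] ℝ}
    (hA : ∀ p ∈ prodDomain T, ContDiffAt ℝ ∞ A (incl p)) (i j : Fin 3) :
    ContinuousOn (fun p => extDerivOne A (incl p) (slotVec B p i) (slotVec B p j))
      (prodDomain T) :=
  ((continuousOn_fderiv_slotVec hB hA i).clm_apply (continuous_slotVec hB j).continuousOn).sub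
    ((continuousOn_fderiv_slotVec hB hA j).clm_apply (continuous_slotVec hB i).continuousOn)

theorem continuousOn_apply_slotVec (hB : IsSVect B) {A : Amb → Amb →L[ℝ] ℝ}
    (hA : ∀ p ∈ prodDomain T, ContDiffAt ℝ ∞ A (incl p)) (i : Fin 3) :
    ContinuousOn (fun p => A (incl p) (slotVec B p i)) (prodDomain T) :=
  (continuousOn_comp_incl hA).clm_apply (continuous_slotVec hB i).continuousOn

theorem continuousOn_wedgeSlots (hB : IsSVect B) {A A' : Amb → Amb →L[ℝ] ℝ}
    (hA : ∀ p ∈ prodDomain T, ContDiffAt ℝ ∞ A (incl p))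
    (hA' : ∀ p ∈ prodDomain T, ContDiffAt ℝ ∞ A' (incl p)) :
    ContinuousOn (wedgeSlots B A A') (prodDomain T) :=
  ((((continuousOn_apply_slotVec hB hA 0).mul (continuousOn_extDerivOne_slotVec hB hA' 1 2)).sub
    ((continuousOn_apply_slotVec hB hA 1).mul (continuousOn_extDerivOne_slotVec hB hA' 0 2))).add
    ((continuousOn_apply_slotVec hB hA 2).mul (continuousOn_extDerivOne_slotVec hB hA' 0 1)))

/-- `∫ A ∧ dA' = ∫ A' ∧ dA` for the form `A ∧ dA'` evaluated on `(B₁, B₂, B₃)`. -/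
theorem integral_wedgeSlots_comm (hB : IsSVect B) (hT : ∀ i, IsHandlebody (T i))
    (htan : ∀ i, IsTangentToBoundary B (T i)) {A A' : Amb → Amb →L[ℝ] ℝ}
    (hA : ∀ p ∈ prodDomain T, ContDiffAt ℝ ∞ A (incl p))
    (hA' : ∀ p ∈ prodDomain T, ContDiffAt ℝ ∞ A' (incl p)) :
    ∫ p in prodDomain T, wedgeSlots B A A' p ∂vol3 =
      ∫ p in prodDomain T, wedgeSlots B A' A p ∂vol3 := by
  have hm : MeasurableSet (prodDomain T) := (isCompact_prodDomain hT).isClosed.measurableSet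
  let a : Fin 3 → Amb → ℝ := fun i q => A q (slotField B i q)
  let a' : Fin 3 → Amb → ℝ := fun i q => A' q (slotField B i q)
  have ha : ∀ i, ∀ p ∈ prodDomain T, ContDiffAt ℝ ∞ (a i) (incl p) := fun i p hp =>
    (hA p hp).clm_apply (contDiffAt_slotField hB p i)
  have ha' : ∀ i, ∀ p ∈ prodDomain T, ContDiffAt ℝ ∞ (a' i) (incl p) := fun i p hp =>
    (hA' p hp).clm_apply (contDiffAt_slotField hB p i)
  let f : Fin 3 → Fin 3 → Amb → ℝ := fun i j q => a i q * a' j q - a j q * a' i q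
  have hf : ∀ i j, ∀ p ∈ prodDomain T, ContDiffAt ℝ ∞ (f i j) (incl p) := fun i j p hp =>
    ((ha i p hp).mul (ha' j p hp)).sub ((ha j p hp).mul (ha' i p hp))
  have hdf : ∀ i j k, ∀ p ∈ prodDomain T, fderiv ℝ (f i j) (incl p) (slotVec B p k) =
      (a i (incl p) * fderiv ℝ (a' j) (incl p) (slotVec B p k)
        + a' j (incl p) * fderiv ℝ (a i) (incl p) (slotVec B p k))
      - (a j (incl p) * fderiv ℝ (a' i) (incl p) (slotVec B p k)
        + a' i (incl p) * fderiv ℝ (a j) (incl p) (slotVec B p k)) := by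
    intro i j k p hp
    have d1 := fun i => ((ha i p hp).differentiableAt (by simp)).hasFDerivAt
    have d2 := fun i => ((ha' i p hp).differentiableAt (by simp)).hasFDerivAt
    have d3 : HasFDerivAt (f i j) _ (incl p) :=
      ((d1 i).mul (d2 j)).sub ((d1 j).mul (d2 i))
    rw [d3.fderiv]
    simp
  have hint : ∀ i j k, IntegrableOn (fun p => fderiv ℝ (f i j) (incl p) (slotVec B p k))
      (prodDomain T) vol3 := fun i j k =>
    integrableOn_of_continuousOn_prodDomain hT (continuousOn_fderiv_slotVec hB (hf i j) k)
  have h1 := integrableOn_of_continuousOn_prodDomain hT (continuousOn_wedgeSlots hB hA hA')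
  have h2 := integrableOn_of_continuousOn_prodDomain hT (continuousOn_wedgeSlots hB hA' hA)
  rw [← sub_eq_zero, ← integral_sub h1 h2]
  have hz := fun i j k => integral_fderiv_slotVec hB hT htan (hf i j) k
  -- Here `f i j` is $(A\wedge A')(B_i,B_j)$. The integrand is $-d(A\wedge A')(B_1,B_2,B_3)$, which
  -- equals the difference of $A\wedge dA'$ and $A'\wedge dA$.
  have hsum : ∫ p in prodDomain T, (fderiv ℝ (f 2 1) (incl p) (slotVec B p 0)
      + fderiv ℝ (f 0 2) (incl p) (slotVec B p 1)
      + fderiv ℝ (f 1 0) (incl p) (slotVec B p 2)) ∂vol3 = 0 := by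
    have h12 : IntegrableOn (fun p => fderiv ℝ (f 2 1) (incl p) (slotVec B p 0)
        + fderiv ℝ (f 0 2) (incl p) (slotVec B p 1)) (prodDomain T) vol3 :=
      (hint 2 1 0).add (hint 0 2 1)
    rw [integral_add h12 (hint 1 0 2), integral_add (hint 2 1 0) (hint 0 2 1), hz, hz, hz]
    simp
  rw [← hsum]
  refine setIntegral_congr_fun hm fun p hp => ?_
  have e1 := fun i j (hij : i ≠ j) =>
    fderiv_apply_slotField hB ((hA p hp).differentiableAt (by simp)) hij
  have e2 := fun i j (hij : i ≠ j) =>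
    fderiv_apply_slotField hB ((hA' p hp).differentiableAt (by simp)) hij
  simp only [hdf _ _ _ p hp, wedgeSlots, extDerivOne, a, a', slotField_incl]
  rw [← e1 1 2 (by decide), ← e1 2 1 (by decide), ← e1 0 2 (by decide), ← e1 2 0 (by decide),
    ← e1 0 1 (by decide), ← e1 1 0 (by decide), ← e2 1 2 (by decide), ← e2 2 1 (by decide),
    ← e2 0 2 (by decide), ← e2 2 0 (by decide), ← e2 0 1 (by decide), ← e2 1 0 (by decide)]
  ring

/-- Two one-forms with the same exterior derivative on `(B₁, B₂, B₃)` have the same helicity. -/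
theorem integral_wedgeSlots_eq_of_extDerivOne_eq (hB : IsSVect B) (hT : ∀ i, IsHandlebody (T i))
    (htan : ∀ i, IsTangentToBoundary B (T i)) {A A' : Amb → Amb →L[ℝ] ℝ}
    (hA : ∀ p ∈ prodDomain T, ContDiffAt ℝ ∞ A (incl p))
    (hA' : ∀ p ∈ prodDomain T, ContDiffAt ℝ ∞ A' (incl p))
    (h : ∀ p ∈ prodDomain T, ∀ i j, extDerivOne A (incl p) (slotVec B p i) (slotVec B p j) =
      extDerivOne A' (incl p) (slotVec B p i) (slotVec B p j)) :
    ∫ p in prodDomain T, wedgeSlots B A A p ∂vol3 =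
      ∫ p in prodDomain T, wedgeSlots B A' A' p ∂vol3 := by
  have hm : MeasurableSet (prodDomain T) := (isCompact_prodDomain hT).isClosed.measurableSet
  calc ∫ p in prodDomain T, wedgeSlots B A A p ∂vol3
      = ∫ p in prodDomain T, wedgeSlots B A A' p ∂vol3 :=
        setIntegral_congr_fun hm fun p hp => by simp only [wedgeSlots, h p hp]
    _ = ∫ p in prodDomain T, wedgeSlots B A' A p ∂vol3 :=
        integral_wedgeSlots_comm hB hT htan hA hA'
    _ = ∫ p in prodDomain T, wedgeSlots B A' A' p ∂vol3 :=
        setIntegral_congr_fun hm fun p hp => by simp only [wedgeSlots, h p hp]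

end OneForms

/-! ### Smooth dependence of integrals on parameters -/

section ParametricIntegral

variable {Z : Type} [NormedAddCommGroup Z] [NormedSpace ℝ Z]

theorem hasFDerivAt_intervalIntegral_of_contDiffOn [ProperSpace Z] {E : Type} [NormedAddCommGroup E]
    [NormedSpace ℝ E] {f : ℝ × Z → E} {V : Set Z} (hV : IsOpen V)
    (hf : ContDiffOn ℝ ∞ f (Set.univ ×ˢ V)) {x : Z} (hx : x ∈ V) (a b : ℝ) :
    HasFDerivAt (fun z => ∫ s in a..b, f (s, z))
      (∫ s in a..b, (fderiv ℝ f (s, x)).comp (ContinuousLinearMap.inr ℝ ℝ Z)) x := by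
  have hopen : IsOpen ((Set.univ : Set ℝ) ×ˢ V) := isOpen_univ.prod hV
  have hfa : ∀ s, ∀ z ∈ V, ContDiffAt ℝ ∞ f (s, z) := fun s z hz =>
    hf.contDiffAt (hopen.mem_nhds ⟨trivial, hz⟩)
  have hD : ContinuousOn (fun y => (fderiv ℝ f y).comp (ContinuousLinearMap.inr ℝ ℝ Z))
      (Set.univ ×ˢ V) := by
    rintro ⟨s, z⟩ ⟨-, hz⟩
    exact ((contDiffAt_fderiv (hfa s z hz)).continuousAt.clm_comp
      continuousAt_const).continuousWithinAt
  obtain ⟨ε, hε, hball⟩ := Metric.nhds_basis_closedBall.mem_iff.1 (hV.mem_nhds hx)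
  obtain ⟨C, hC⟩ := (isCompact_uIcc (a := a) (b := b)).prod (isCompact_closedBall x ε)
    |>.exists_bound_of_continuousOn (hD.mono (Set.prod_mono (Set.subset_univ _) hball))
  have hcs : ∀ z ∈ V, Continuous fun s => f (s, z) := fun z hz =>
    continuous_iff_continuousAt.2 fun s =>
      ContinuousAt.comp (f := fun s : ℝ => (s, z)) (hfa s z hz).continuousAt (by fun_prop)
  have hDs : Continuous fun s => (fderiv ℝ f (s, x)).comp (ContinuousLinearMap.inr ℝ ℝ Z) :=
    continuous_iff_continuousAt.2 fun s =>
      (ContinuousAt.comp (f := fun s : ℝ => (s, x)) (contDiffAt_fderiv (hfa s x hx)).continuousAt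
        (by fun_prop)).clm_comp continuousAt_const
  refine intervalIntegral.hasFDerivAt_integral_of_dominated_of_fderiv_le
    (F := fun z s => f (s, z)) (bound := fun _ => C)
    (F' := fun z s => (fderiv ℝ f (s, z)).comp (ContinuousLinearMap.inr ℝ ℝ Z))
    (Metric.closedBall_mem_nhds x hε) ?_ ((hcs x hx).intervalIntegrable _ _)
    hDs.aestronglyMeasurable ?_ (by simp) ?_
  · filter_upwards [hV.mem_nhds hx] with z hz
    exact (hcs z hz).aestronglyMeasurable
  · refine Eventually.of_forall fun s hs z hz => ?_
    exact hC (s, z) ⟨Set.uIoc_subset_uIcc hs, hz⟩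
  · refine Eventually.of_forall fun s hs z hz => ?_
    exact ((hfa s z (hball hz)).differentiableAt (by simp)).hasFDerivAt.comp z
      (hasFDerivAt_prodMk_right s z)

theorem contDiffOn_comp_inr_fderiv {E : Type} [NormedAddCommGroup E]
    [NormedSpace ℝ E] {f : ℝ × Z → E} {V : Set Z} (hV : IsOpen V)
    (hf : ContDiffOn ℝ ∞ f (Set.univ ×ˢ V)) :
    ContDiffOn ℝ ∞ (fun y => (fderiv ℝ f y).comp (ContinuousLinearMap.inr ℝ ℝ Z))
      (Set.univ ×ˢ V) := by
  intro y hy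
  exact ((contDiffAt_fderiv (hf.contDiffAt ((isOpen_univ.prod hV).mem_nhds hy))).clm_comp
    contDiffAt_const).contDiffWithinAt

theorem contDiffOn_intervalIntegral [ProperSpace Z] {E : Type} [NormedAddCommGroup E]
    [NormedSpace ℝ E] {f : ℝ × Z → E} {V : Set Z} (hV : IsOpen V)
    (hf : ContDiffOn ℝ ∞ f (Set.univ ×ˢ V)) (a b : ℝ) :
    ContDiffOn ℝ ∞ (fun z => ∫ s in a..b, f (s, z)) V := by
  rw [contDiffOn_infty]
  intro n
  -- The target space varies because the derivative is an integral of the same kind with values in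
  -- continuous linear maps.
  induction n generalizing E with
  | zero =>
    rw [Nat.cast_zero, contDiffOn_zero]
    exact fun x hx =>
      (hasFDerivAt_intervalIntegral_of_contDiffOn hV hf hx a b).continuousAt.continuousWithinAt
  | succ n ih =>
    have hd := fun x (hx : x ∈ V) => hasFDerivAt_intervalIntegral_of_contDiffOn hV hf hx a b
    rw [Nat.cast_succ, contDiffOn_succ_iff_fderiv_of_isOpen hV]
    refine ⟨fun x hx => (hd x hx).differentiableAt.differentiableWithinAt, by simp, ?_⟩
    exact (ih (contDiffOn_comp_inr_fderiv hV hf)).congr fun x hx => (hd x hx).fderiv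

end ParametricIntegral

/-! ### The area form and its pull-backs -/

section AreaForm

set_option maxSynthPendingDepth 3

/-- The determinant of three vectors, as a continuous trilinear map. -/
def tripleDet : EuclideanSpace ℝ (Fin 3) →L[ℝ] EuclideanSpace ℝ (Fin 3) →L[ℝ]
    EuclideanSpace ℝ (Fin 3) →L[ℝ] ℝ :=
  let π : Fin 3 → EuclideanSpace ℝ (Fin 3) →L[ℝ] ℝ := fun i => EuclideanSpace.proj i
  (π 0).smulRight ((π 1).smulRight (π 2) - (π 2).smulRight (π 1))
  + (π 1).smulRight ((π 2).smulRight (π 0) - (π 0).smulRight (π 2))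
  + (π 2).smulRight ((π 0).smulRight (π 1) - (π 1).smulRight (π 0))

theorem tripleDet_apply (a b c : EuclideanSpace ℝ (Fin 3)) :
    tripleDet a b c = a 0 * (b 1 * c 2 - b 2 * c 1) + a 1 * (b 2 * c 0 - b 0 * c 2)
      + a 2 * (b 0 * c 1 - b 1 * c 0) := by
  simp [tripleDet]

theorem areaForm_apply (a b c : EuclideanSpace ℝ (Fin 3)) :
    areaForm a ![b, c] = tripleDet a b c := by
  rw [tripleDet_apply]
  change (EuclideanSpace.basisFun (Fin 3) ℝ).toBasis.det ![a, b, c] = _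
  rw [Module.Basis.det_apply, Matrix.det_fin_three]
  simp [Module.Basis.toMatrix_apply]
  ring

/-- Up to a factor the left side is the square of the two-form $\det(h,\cdot,\cdot)$, a four-form on
$\mathbb R^3$. -/
theorem tripleDet_pluecker (h a b c d : EuclideanSpace ℝ (Fin 3)) :
    tripleDet h a b * tripleDet h c d - tripleDet h a c * tripleDet h b d
      + tripleDet h a d * tripleDet h b c = 0 := by
  simp only [tripleDet_apply]; ring

theorem tripleDet_eq_zero_of_inner_eq_zero {n a b c : EuclideanSpace ℝ (Fin 3)} (hn : n ≠ 0)
    (ha : inner ℝ n a = 0) (hb : inner ℝ n b = 0) (hc : inner ℝ n c = 0) :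
    tripleDet a b c = 0 := by
  simp only [PiLp.inner_apply, Fin.sum_univ_three, RCLike.inner_apply, conj_trivial] at ha hb hc
  by_contra hne
  apply hn
  ext i
  have key : tripleDet a b c * n i = 0 := by
    rw [tripleDet_apply]
    fin_cases i <;> simp only [Fin.zero_eta, Fin.mk_one, Fin.reduceFinMk]
    -- The coefficients are the components of $b\times c$, $c\times a$ and $a\times b$, the
    -- cofactors of the matrix with rows $a,b,c$.
    · linear_combination (b 1 * c 2 - b 2 * c 1) * ha + (c 1 * a 2 - c 2 * a 1) * hb
        + (a 1 * b 2 - a 2 * b 1) * hc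
    · linear_combination (b 2 * c 0 - b 0 * c 2) * ha + (c 2 * a 0 - c 0 * a 2) * hb
        + (a 2 * b 0 - a 0 * b 2) * hc
    · linear_combination (b 0 * c 1 - b 1 * c 0) * ha + (c 0 * a 1 - c 1 * a 0) * hb
        + (a 0 * b 1 - a 1 * b 0) * hc
  simpa [hne] using key

variable {Y : Type*} [NormedAddCommGroup Y] [NormedSpace ℝ Y]

/-- The pull-back of the area form of `S²` by `F`. -/
def pullArea (F : Y → EuclideanSpace ℝ (Fin 3)) (y u v : Y) : ℝ :=
  tripleDet (F y) (fderiv ℝ F y u) (fderiv ℝ F y v)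

theorem fderiv_pullArea {F : Y → EuclideanSpace ℝ (Fin 3)} {y : Y} (hF : ContDiffAt ℝ ∞ F y)
    (u v w : Y) :
    fderiv ℝ (fun z => pullArea F z v w) y u =
      tripleDet (fderiv ℝ F y u) (fderiv ℝ F y v) (fderiv ℝ F y w)
      + tripleDet (F y) (fderiv ℝ (fderiv ℝ F) y u v) (fderiv ℝ F y w)
      + tripleDet (F y) (fderiv ℝ F y v) (fderiv ℝ (fderiv ℝ F) y u w) := by
  have h0 := (hF.differentiableAt (by simp)).hasFDerivAt
  have h1 := ((contDiffAt_fderiv hF).differentiableAt (by simp)).hasFDerivAt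
  have hc := fun v : Y => h1.clm_apply (hasFDerivAt_const v y)
  have h := ((tripleDet.hasFDerivAt.comp y h0).clm_apply (hc v)).clm_apply (hc w)
  have h' : HasFDerivAt (fun z => pullArea F z v w) _ y := h
  rw [h'.fderiv]
  simp
  ring

theorem inner_fderiv_eq_zero_of_norm_eq_one {E : Type*} [NormedAddCommGroup E]
    [InnerProductSpace ℝ E] {F : Y → E} {y : Y} (hF : DifferentiableAt ℝ F y) (hn : ∀ᶠ z in 𝓝 y, ‖F z‖ = 1) (u : Y) :
    inner ℝ (F y) (fderiv ℝ F y u) = 0 := by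
  have h1 := hF.hasFDerivAt.norm_sq
  have h2 : HasFDerivAt (fun z => ‖F z‖ ^ 2) (0 : Y →L[ℝ] ℝ) y :=
    (hasFDerivAt_const (1 : ℝ) y).congr_of_eventuallyEq (hn.mono fun z hz => by simp [hz])
  have h3 := congrArg (fun L : Y →L[ℝ] ℝ => L u) (h1.unique h2)
  simpa using h3

/-- The pull-back of the area form of `S²` is closed. -/
theorem pullArea_closed {F : Y → EuclideanSpace ℝ (Fin 3)} {y : Y} (hF : ContDiffAt ℝ ∞ F y)
    (hn : ∀ᶠ z in 𝓝 y, ‖F z‖ = 1) (u v w : Y) :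
    fderiv ℝ (fun z => pullArea F z v w) y u - fderiv ℝ (fun z => pullArea F z u w) y v
      + fderiv ℝ (fun z => pullArea F z u v) y w = 0 := by
  have hs : ∀ a b, fderiv ℝ (fderiv ℝ F) y a b = fderiv ℝ (fderiv ℝ F) y b a := fun a b =>
    (hF.isSymmSndFDerivAt (by simpa using ENat.LEInfty.out)).eq a b
  have hd := inner_fderiv_eq_zero_of_norm_eq_one (hF.differentiableAt (by simp)) hn
  have hne : F y ≠ 0 := by
    intro h; have := hn.self_of_nhds; rw [h, norm_zero] at this; exact zero_ne_one this
  have hz := tripleDet_eq_zero_of_inner_eq_zero hne (hd u) (hd v) (hd w)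
  -- Second derivatives cancel by symmetry. What remains is three times the determinant of three
  -- vectors tangent to the sphere at `F y`.
  rw [fderiv_pullArea hF, fderiv_pullArea hF, fderiv_pullArea hF, hs v u, hs w u, hs w v]
  simp only [tripleDet_apply] at hz ⊢
  linear_combination 3 * hz

end AreaForm

/-! ### The homotopy formula for the pulled back area form -/

section Homotopy

set_option maxSynthPendingDepth 3

variable {Z : Type} [NormedAddCommGroup Z] [NormedSpace ℝ Z]
  {F : ℝ × Z → EuclideanSpace ℝ (Fin 3)} {W : Set Z}

/-- The contraction of the pulled back area form with the time direction. -/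
def etaForm (F : ℝ × Z → EuclideanSpace ℝ (Fin 3)) (y : ℝ × Z) : Z →L[ℝ] ℝ :=
  (tripleDet (F y) (fderiv ℝ F y (1, 0))).comp
    ((fderiv ℝ F y).comp (ContinuousLinearMap.inr ℝ ℝ Z))

theorem etaForm_apply (y : ℝ × Z) (u : Z) :
    etaForm F y u = pullArea F y (1, 0) (0, u) := rfl

/-- The primitive in time of `etaForm`. -/
def kappaForm (F : ℝ × Z → EuclideanSpace ℝ (Fin 3)) (t : ℝ) (z : Z) : Z →L[ℝ] ℝ :=
  ∫ s in (0 : ℝ)..t, etaForm F (s, z)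

theorem contDiffAt_pullArea {y : ℝ × Z} (hF : ContDiffAt ℝ ∞ F y) (u v : ℝ × Z) :
    ContDiffAt ℝ ∞ (fun z => pullArea F z u v) y :=
  ((tripleDet.contDiff.contDiffAt.comp y hF).clm_apply
    ((contDiffAt_fderiv hF).clm_apply contDiffAt_const)).clm_apply
    ((contDiffAt_fderiv hF).clm_apply contDiffAt_const)

theorem contDiffAt_etaForm {y : ℝ × Z} (hF : ContDiffAt ℝ ∞ F y) :
    ContDiffAt ℝ ∞ (etaForm F) y :=
  ((tripleDet.contDiff.contDiffAt.comp y hF).clm_apply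
    ((contDiffAt_fderiv hF).clm_apply contDiffAt_const)).clm_comp
    ((contDiffAt_fderiv hF).clm_comp contDiffAt_const)

theorem contDiffAt_of_contDiffOn_univ_prod {E : Type*} [NormedAddCommGroup E] [NormedSpace ℝ E]
    {f : ℝ × Z → E} (hW : IsOpen W)
    (hf : ContDiffOn ℝ ∞ f (Set.univ ×ˢ W)) (t : ℝ) {z : Z} (hz : z ∈ W) :
    ContDiffAt ℝ ∞ f (t, z) :=
  hf.contDiffAt ((isOpen_univ.prod hW).mem_nhds ⟨trivial, hz⟩)

theorem contDiffOn_etaForm (hW : IsOpen W) (hF : ContDiffOn ℝ ∞ F (Set.univ ×ˢ W)) :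
    ContDiffOn ℝ ∞ (etaForm F) (Set.univ ×ˢ W) := fun _ hy =>
  (contDiffAt_etaForm (hF.contDiffAt ((isOpen_univ.prod hW).mem_nhds hy))).contDiffWithinAt

theorem fderiv_etaForm_slice {t : ℝ} {z : Z} (hF : ContDiffAt ℝ ∞ F (t, z)) (u v : Z) :
    fderiv ℝ (fun q => etaForm F (t, q)) z u v =
      fderiv ℝ (fun y => pullArea F y (1, 0) (0, v)) (t, z) (0, u) := by
  have h1 : HasFDerivAt (fun q => etaForm F (t, q)) _ z :=
    ((contDiffAt_etaForm hF).differentiableAt (by simp)).hasFDerivAt.comp z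
      (hasFDerivAt_prodMk_right t z)
  have h2 : HasFDerivAt (fun q => etaForm F (t, q) v) _ z :=
    h1.clm_apply (hasFDerivAt_const v z)
  have h3 : HasFDerivAt (fun q => etaForm F (t, q) v) _ z :=
    (((contDiffAt_pullArea hF (1, 0) (0, v)).differentiableAt
      (by simp)).hasFDerivAt).comp z (hasFDerivAt_prodMk_right t z)
  have h4 := congrArg (fun L : Z →L[ℝ] ℝ => L u) (h2.unique h3)
  rw [h1.fderiv]
  simpa using h4

/-- Closedness of $F^*\nu$ on $(\partial_t,u,v)$, which reads $\partial_t\omega_t=d\eta_t$. -/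
theorem hasDerivAt_pullArea {t : ℝ} {z : Z} (hF : ContDiffAt ℝ ∞ F (t, z))
    (hn : ∀ᶠ y in 𝓝 (t, z), ‖F y‖ = 1) (u v : Z) :
    HasDerivAt (fun s => pullArea F (s, z) (0, u) (0, v))
      (extDerivOne (fun q => etaForm F (t, q)) z u v) t := by
  have h1 := ((contDiffAt_pullArea hF (0, u) (0, v)).differentiableAt
      (by simp)).hasFDerivAt.comp_hasDerivAt t ((hasDerivAt_id t).prodMk (hasDerivAt_const t z))
  have h2 := pullArea_closed hF hn (1, 0) (0, u) (0, v)
  rw [extDerivOne, fderiv_etaForm_slice hF, fderiv_etaForm_slice hF]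
  exact HasDerivAt.congr_deriv h1 (by linarith)

theorem continuous_etaForm_time (hW : IsOpen W) (hF : ContDiffOn ℝ ∞ F (Set.univ ×ˢ W)) {z : Z}
    (hz : z ∈ W) : Continuous fun s => etaForm F (s, z) :=
  continuous_iff_continuousAt.2 fun s =>
    ContinuousAt.comp (f := fun s : ℝ => (s, z))
      (contDiffAt_etaForm (contDiffAt_of_contDiffOn_univ_prod hW hF s hz)).continuousAt
      (by fun_prop)

theorem hasDerivAt_kappaForm (hW : IsOpen W) (hF : ContDiffOn ℝ ∞ F (Set.univ ×ˢ W)) {z : Z}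
    (hz : z ∈ W) (t : ℝ) : HasDerivAt (fun s => kappaForm F s z) (etaForm F (t, z)) t :=
  (continuous_etaForm_time hW hF hz).integral_hasStrictDerivAt 0 t |>.hasDerivAt

theorem contDiffOn_kappaForm [ProperSpace Z] (hW : IsOpen W)
    (hF : ContDiffOn ℝ ∞ F (Set.univ ×ˢ W)) :
    ContDiffOn ℝ ∞ (fun y : ℝ × Z => kappaForm F y.1 y.2) (Set.univ ×ˢ W) := by
  -- Rescaling the integration variable by `t` fixes the endpoints at `0` and `1`, so `t` becomes a
  -- parameter like `z`.
  have h1 : ContDiffOn ℝ ∞ (fun x : ℝ × (ℝ × Z) => etaForm F (x.2.1 * x.1, x.2.2))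
      (Set.univ ×ˢ (Set.univ ×ˢ W)) :=
    (contDiffOn_etaForm hW hF).comp
      (f := fun x : ℝ × (ℝ × Z) => (x.2.1 * x.1, x.2.2)) (by fun_prop)
      (fun x hx => ⟨trivial, hx.2.2⟩)
  have h2 := contDiffOn_intervalIntegral (isOpen_univ.prod hW) h1 0 1
  have h3 : ContDiffOn ℝ ∞ (fun y : ℝ × Z => y.1 • ∫ s in (0 : ℝ)..1, etaForm F (y.1 * s, y.2))
      (Set.univ ×ˢ W) := contDiffOn_fst.smul h2
  refine h3.congr fun y _ => ?_
  have := intervalIntegral.smul_integral_comp_mul_left (a := 0) (b := 1)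
    (fun s => etaForm F (s, y.2)) y.1
  rw [this, kappaForm, mul_zero, mul_one]

/-- Differentiation under the integral sign gives $d\kappa_t=\int_0^t
d\eta_s\,ds=\int_0^t\partial_s\omega_s\,ds$, and the fundamental theorem of calculus applies. -/
theorem extDerivOne_kappaForm [ProperSpace Z] (hW : IsOpen W)
    (hF : ContDiffOn ℝ ∞ F (Set.univ ×ˢ W))
    (hn : ∀ y ∈ Set.univ ×ˢ W, ‖F y‖ = 1) {z : Z} (hz : z ∈ W) (t : ℝ) (u v : Z) :
    extDerivOne (kappaForm F t) z u v =
      pullArea F (t, z) (0, u) (0, v) - pullArea F (0, z) (0, u) (0, v) := by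
  have hFa := fun s => contDiffAt_of_contDiffOn_univ_prod hW hF s hz
  have hna : ∀ s, ∀ᶠ y in 𝓝 (s, z), ‖F y‖ = 1 := fun s =>
    Filter.mem_of_superset ((isOpen_univ.prod hW).mem_nhds ⟨trivial, hz⟩) hn
  have h1 : HasFDerivAt (kappaForm F t) _ z :=
    hasFDerivAt_intervalIntegral_of_contDiffOn hW (contDiffOn_etaForm hW hF) hz 0 t
  let L : ℝ → Z →L[ℝ] Z →L[ℝ] ℝ := fun s =>
    (fderiv ℝ (etaForm F) (s, z)).comp (ContinuousLinearMap.inr ℝ ℝ Z)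
  have hLc : Continuous L :=
    continuous_iff_continuousAt.2 fun s =>
      (ContinuousAt.comp (f := fun s : ℝ => (s, z))
        (contDiffAt_fderiv (contDiffAt_etaForm (hFa s))).continuousAt (by fun_prop)).clm_comp
        continuousAt_const
  have hL : ∀ s, L s = fderiv ℝ (fun q => etaForm F (s, q)) z := fun s =>
    (HasFDerivAt.fderiv (((contDiffAt_etaForm (hFa s)).differentiableAt
      (by simp)).hasFDerivAt.comp z (hasFDerivAt_prodMk_right s z))).symm
  have h2 : ∀ u v, fderiv ℝ (kappaForm F t) z u v = ∫ s in (0 : ℝ)..t, L s u v := by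
    intro u v
    have hLu : Continuous fun s => L s u := hLc.clm_apply continuous_const
    rw [h1.fderiv, ContinuousLinearMap.intervalIntegral_apply (hLc.intervalIntegrable _ _),
      ContinuousLinearMap.intervalIntegral_apply (hLu.intervalIntegrable _ _)]
  have hLuv : ∀ u v, Continuous fun s => L s u v := fun u v =>
    (hLc.clm_apply continuous_const).clm_apply continuous_const
  rw [extDerivOne, h2, h2, ← intervalIntegral.integral_sub ((hLuv u v).intervalIntegrable _ _)
    ((hLuv v u).intervalIntegrable _ _)]
  refine intervalIntegral.integral_eq_sub_of_hasDerivAt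
    (f := fun s => pullArea F (s, z) (0, u) (0, v)) (fun s _ => ?_)
    (((hLuv u v).sub (hLuv v u)).intervalIntegrable _ _)
  have := hasDerivAt_pullArea (hFa s) (hna s) u v
  rwa [extDerivOne, ← hL] at this

end Homotopy

/-! ### Constancy of the helicity along the isotopy -/

section HelicityHomotopy

set_option maxSynthPendingDepth 3

variable {B : VField} {T : Fin 3 → Set S3} {F : ℝ × Amb → EuclideanSpace ℝ (Fin 3)} {W : Set Amb}

/-- The value on `(B₁, B₂, B₃)` of the wedge product of a one-form and the pulled back area
form. -/
def wedgeArea (B : VField) (A : Amb → Amb →L[ℝ] ℝ) (F : ℝ × Amb → EuclideanSpace ℝ (Fin 3)) (t : ℝ)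
    (p : Fin 3 → S3) : ℝ :=
  A (incl p) (slotVec B p 0) * pullArea F (t, incl p) (0, slotVec B p 1) (0, slotVec B p 2)
  - A (incl p) (slotVec B p 1) * pullArea F (t, incl p) (0, slotVec B p 0) (0, slotVec B p 2)
  + A (incl p) (slotVec B p 2) * pullArea F (t, incl p) (0, slotVec B p 0) (0, slotVec B p 1)

/-- Up to a factor $\eta_t\wedge\omega_t$ is the contraction of $F^*(\nu\wedge\nu)=0$ with
$\partial_t$. Pointwise this is the Plücker relation. -/
theorem wedgeArea_etaForm (t : ℝ) (p : Fin 3 → S3) :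
    wedgeArea B (fun q => etaForm F (t, q)) F t p = 0 := by
  simp only [wedgeArea, etaForm_apply, pullArea]
  have := tripleDet_pluecker (F (t, incl p)) (fderiv ℝ F (t, incl p) (1, 0))
    (fderiv ℝ F (t, incl p) (0, slotVec B p 0)) (fderiv ℝ F (t, incl p) (0, slotVec B p 1))
    (fderiv ℝ F (t, incl p) (0, slotVec B p 2))
  linarith

theorem contDiffAt_kappaForm (hW : IsOpen W)
    (hF : ContDiffOn ℝ ∞ F (Set.univ ×ˢ W)) (t : ℝ) {q : Amb} (hq : q ∈ W) :
    ContDiffAt ℝ ∞ (kappaForm F t) q :=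
  (contDiffAt_of_contDiffOn_univ_prod hW (contDiffOn_kappaForm hW hF) t hq).comp
    (f := fun q => (t, q)) q (contDiffAt_const.prodMk contDiffAt_id)

/-- Joint continuity in time and position yields the uniform bound, over a compact time interval,
for differentiating the helicity under the integral. -/
theorem continuousOn_wedgeSlots_etaForm (hB : IsSVect B) (hW : IsOpen W)
    (hTW : ∀ p ∈ prodDomain T, incl p ∈ W) (hF : ContDiffOn ℝ ∞ F (Set.univ ×ˢ W))
    {A : Amb → Amb →L[ℝ] ℝ} (hA : ∀ p ∈ prodDomain T, ContDiffAt ℝ ∞ A (incl p)) :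
    ContinuousOn (fun x : ℝ × (Fin 3 → S3) =>
      wedgeSlots B (fun q => A q + kappaForm F x.1 q) (fun q => etaForm F (x.1, q)) x.2)
      (Set.univ ×ˢ prodDomain T) := by
  have hFa := fun t p (hp : p ∈ prodDomain T) =>
    contDiffAt_of_contDiffOn_univ_prod hW hF t (hTW p hp)
  have hincl : Continuous fun x : ℝ × (Fin 3 → S3) => (x.1, incl x.2) :=
    continuous_fst.prodMk (continuous_incl.comp continuous_snd)
  have hs : ∀ i, ContinuousOn (fun x : ℝ × (Fin 3 → S3) => slotVec B x.2 i)
      (Set.univ ×ˢ prodDomain T) := fun i =>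
    ((continuous_slotVec hB i).comp continuous_snd).continuousOn
  have hmaps : Set.MapsTo (fun x : ℝ × (Fin 3 → S3) => (x.1, incl x.2))
      (Set.univ ×ˢ prodDomain T) (Set.univ ×ˢ W) := fun x hx => ⟨trivial, hTW _ hx.2⟩
  have hA1 : ContinuousOn (fun x : ℝ × (Fin 3 → S3) => A (incl x.2))
      (Set.univ ×ˢ prodDomain T) :=
    (continuousOn_comp_incl hA).comp continuousOn_snd (fun x hx => hx.2)
  have hA2 : ContinuousOn (fun x : ℝ × (Fin 3 → S3) => kappaForm F x.1 (incl x.2))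
      (Set.univ ×ˢ prodDomain T) :=
    (contDiffOn_kappaForm hW hF).continuousOn.comp
      (f := fun x : ℝ × (Fin 3 → S3) => (x.1, incl x.2)) hincl.continuousOn hmaps
  have hηc : ContinuousOn (fun x : ℝ × (Fin 3 → S3) =>
      fderiv ℝ (fun q => etaForm F (x.1, q)) (incl x.2)) (Set.univ ×ˢ prodDomain T) := by
    have h1 := (contDiffOn_comp_inr_fderiv hW (contDiffOn_etaForm hW hF)).continuousOn.comp
      hincl.continuousOn hmaps
    refine h1.congr fun x hx => ?_
    exact HasFDerivAt.fderiv (((contDiffAt_etaForm (hFa x.1 x.2 hx.2)).differentiableAt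
      (by simp)).hasFDerivAt.comp (incl x.2) (hasFDerivAt_prodMk_right x.1 (incl x.2)))
  have hac := fun i => (hA1.add hA2).clm_apply (hs i)
  have hdc : ∀ i j, ContinuousOn (fun x : ℝ × (Fin 3 → S3) =>
      extDerivOne (fun q => etaForm F (x.1, q)) (incl x.2) (slotVec B x.2 i) (slotVec B x.2 j))
      (Set.univ ×ˢ prodDomain T) := fun i j =>
    ((hηc.clm_apply (hs i)).clm_apply (hs j)).sub ((hηc.clm_apply (hs j)).clm_apply (hs i))
  exact (((hac 0).mul (hdc 1 2)).sub ((hac 1).mul (hdc 0 2))).add ((hac 2).mul (hdc 0 1))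

/-- The helicity of a one-form does not change when the primitive of the isotopy is added to
it. -/
theorem integral_wedgeSlots_add_kappaForm (hB : IsSVect B) (hT : ∀ i, IsHandlebody (T i))
    (htan : ∀ i, IsTangentToBoundary B (T i)) (hW : IsOpen W)
    (hTW : ∀ p ∈ prodDomain T, incl p ∈ W) (hF : ContDiffOn ℝ ∞ F (Set.univ ×ˢ W))
    (hn : ∀ y ∈ Set.univ ×ˢ W, ‖F y‖ = 1) {A : Amb → Amb →L[ℝ] ℝ}
    (hA : ∀ p ∈ prodDomain T, ContDiffAt ℝ ∞ A (incl p))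
    (hdA : ∀ p ∈ prodDomain T, ∀ i j, extDerivOne A (incl p) (slotVec B p i) (slotVec B p j) =
      pullArea F (0, incl p) (0, slotVec B p i) (0, slotVec B p j)) (t : ℝ) :
    ∫ p in prodDomain T,
        wedgeSlots B (fun q => A q + kappaForm F t q) (fun q => A q + kappaForm F t q) p ∂vol3 =
      ∫ p in prodDomain T, wedgeSlots B A A p ∂vol3 := by
  have hm : MeasurableSet (prodDomain T) := (isCompact_prodDomain hT).isClosed.measurableSet
  have hFa := fun t p (hp : p ∈ prodDomain T) =>
    contDiffAt_of_contDiffOn_univ_prod hW hF t (hTW p hp)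
  have hna : ∀ t, ∀ p ∈ prodDomain T, ∀ᶠ y in 𝓝 (t, incl p), ‖F y‖ = 1 := fun t p hp =>
    Filter.mem_of_superset ((isOpen_univ.prod hW).mem_nhds ⟨trivial, hTW p hp⟩) hn
  let At : ℝ → Amb → Amb →L[ℝ] ℝ := fun t q => A q + kappaForm F t q
  let ηt : ℝ → Amb → Amb →L[ℝ] ℝ := fun t q => etaForm F (t, q)
  have hκ := fun t p (hp : p ∈ prodDomain T) => contDiffAt_kappaForm hW hF t (hTW p hp)
  have hAt : ∀ t, ∀ p ∈ prodDomain T, ContDiffAt ℝ ∞ (At t) (incl p) := fun t p hp =>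
    (hA p hp).add (hκ t p hp)
  have hηt : ∀ t, ∀ p ∈ prodDomain T, ContDiffAt ℝ ∞ (ηt t) (incl p) := fun t p hp =>
    (contDiffAt_etaForm (hFa t p hp)).comp (f := fun q => (t, q)) (incl p)
      (contDiffAt_const.prodMk contDiffAt_id)
  have hdAt : ∀ t, ∀ p ∈ prodDomain T, ∀ i j,
      extDerivOne (At t) (incl p) (slotVec B p i) (slotVec B p j) =
        pullArea F (t, incl p) (0, slotVec B p i) (0, slotVec B p j) := by
    intro t p hp i j
    have h1 : fderiv ℝ (At t) (incl p) = fderiv ℝ A (incl p) + fderiv ℝ (kappaForm F t) (incl p) :=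
      fderiv_add ((hA p hp).differentiableAt (by simp)) ((hκ t p hp).differentiableAt (by simp))
    have h2 := extDerivOne_kappaForm hW hF hn (hTW p hp) t (slotVec B p i) (slotVec B p j)
    have h3 := hdA p hp i j
    simp only [extDerivOne, h1, add_apply] at h2 h3 ⊢
    linarith
  have hwedge : ∀ t, ∀ A' : Amb → Amb →L[ℝ] ℝ, ∀ p ∈ prodDomain T,
      wedgeSlots B A' (At t) p = wedgeArea B A' F t p := by
    intro t A' p hp
    simp only [wedgeSlots, wedgeArea, hdAt t p hp]
  -- The product rule gives $\eta_t\wedge\omega_t+\alpha_t\wedge d\eta_t$, and the first term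
  -- vanishes pointwise.
  have hderiv : ∀ t, ∀ p ∈ prodDomain T, HasDerivAt (fun s => wedgeSlots B (At s) (At s) p)
      (wedgeSlots B (At t) (ηt t) p) t := by
    intro t p hp
    have e : (fun s => wedgeSlots B (At s) (At s) p) = fun s => wedgeArea B (At s) F s p := by
      ext s; exact hwedge s (At s) p hp
    rw [e]
    have ha : ∀ i, HasDerivAt (fun s => At s (incl p) (slotVec B p i))
        (ηt t (incl p) (slotVec B p i)) t := by
      intro i
      have := ((hasDerivAt_kappaForm hW hF (hTW p hp) t).const_add (A (incl p))).clm_apply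
        (hasDerivAt_const t (slotVec B p i))
      exact this.congr_deriv (by simp [ηt])
    have hw := fun i j => hasDerivAt_pullArea (hFa t p hp) (hna t p hp) (slotVec B p i)
      (slotVec B p j)
    have h := (((ha 0).mul (hw 1 2)).sub ((ha 1).mul (hw 0 2))).add ((ha 2).mul (hw 0 1))
    refine h.congr_deriv ?_
    have hp0 := wedgeArea_etaForm (B := B) (F := F) t p
    simp only [wedgeArea] at hp0
    simp only [wedgeSlots, ηt]
    linear_combination hp0
  have hcont := continuousOn_wedgeSlots_etaForm hB hW hTW hF hA
  have hJ : ∀ t, HasDerivAt (fun s => ∫ p in prodDomain T, wedgeSlots B (At s) (At s) p ∂vol3)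
      0 t := by
    intro t
    obtain ⟨C, hC⟩ := ((isCompact_Icc (a := t - 1) (b := t + 1)).prod
      (isCompact_prodDomain hT)).exists_bound_of_continuousOn
      (hcont.mono (Set.prod_mono (Set.subset_univ _) subset_rfl))
    have h := (hasDerivAt_integral_of_dominated_loc_of_deriv_le
      (μ := vol3.restrict (prodDomain T)) (bound := fun _ => C) (s := Set.Icc (t - 1) (t + 1))
      (x₀ := t) (F := fun s p => wedgeSlots B (At s) (At s) p)
      (F' := fun s p => wedgeSlots B (At s) (ηt s) p)
      (Icc_mem_nhds (by linarith) (by linarith))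
      (Eventually.of_forall fun s =>
        (continuousOn_wedgeSlots hB (hAt s) (hAt s)).aestronglyMeasurable hm)
      (integrableOn_of_continuousOn_prodDomain hT (continuousOn_wedgeSlots hB (hAt t) (hAt t)))
      ((continuousOn_wedgeSlots hB (hAt t) (hηt t)).aestronglyMeasurable hm)
      ((ae_restrict_iff' hm).2 (Eventually.of_forall fun p hp s hs => hC (s, p) ⟨hs, hp⟩))
      (integrable_const C)
      ((ae_restrict_iff' hm).2 (Eventually.of_forall fun p hp s _ => hderiv s p hp))).2
    -- Symmetry turns $\int\alpha_t\wedge d\eta_t$ into $\int\eta_t\wedge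
    -- d\alpha_t=\int\eta_t\wedge\omega_t$, which is zero again.
    rw [integral_wedgeSlots_comm hB hT htan (hAt t) (hηt t),
      setIntegral_congr_fun hm (g := fun _ => (0 : ℝ)) (fun p hp => by
        simp only []
        rw [hwedge t _ p hp]; exact wedgeArea_etaForm t p)] at h
    simpa using h
  have hconst := is_const_of_deriv_eq_zero (fun t => (hJ t).differentiableAt)
    (fun t => (hJ t).deriv) t 0
  refine hconst.trans (setIntegral_congr_fun hm fun p hp => ?_)
  have : At 0 = A := by
    ext1 q; simp [At, kappaForm]
  simp only [this]

end HelicityHomotopy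

/-! ### Smoothness of the map to the two-sphere -/

section ConfMap

set_option maxSynthPendingDepth 3

/-- The real part, as a continuous linear map. -/
def reCLM : ℍ[ℝ] →L[ℝ] ℝ :=
  LinearMap.toContinuousLinearMap
    { toFun := fun q => q.re
      map_add' := fun _ _ => rfl
      map_smul' := fun _ _ => rfl }

/-- The imaginary part, as a continuous linear map to `ℝ³`. -/
def imCLM : ℍ[ℝ] →L[ℝ] EuclideanSpace ℝ (Fin 3) :=
  LinearMap.toContinuousLinearMap
    { toFun := fun q => !₂[q.imI, q.imJ, q.imK]
      map_add' := fun a b => by ext i; fin_cases i <;> rfl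
      map_smul' := fun c a => by ext i; fin_cases i <;> rfl }

theorem contDiffAt_stereo {q : ℍ[ℝ]} (hq : q.re ≠ 1) : ContDiffAt ℝ ∞ stereo q := by
  have h : ContDiffAt ℝ ∞ (fun q => (1 - reCLM q)⁻¹ • imCLM q) q :=
    ((contDiffAt_const.sub reCLM.contDiff.contDiffAt).inv (sub_ne_zero.2 hq.symm)).smul
      imCLM.contDiff.contDiffAt
  exact h

theorem sum_sq_of_norm_eq_one {q : ℍ[ℝ]} (hq : ‖q‖ = 1) :
    q.re ^ 2 + q.imI ^ 2 + q.imJ ^ 2 + q.imK ^ 2 = 1 := by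
  rw [← Quaternion.normSq_def', Quaternion.normSq_eq_norm_mul_self, hq, one_mul]

theorem re_ne_one {q : ℍ[ℝ]} (hq : ‖q‖ = 1) (h1 : q ≠ 1) : q.re ≠ 1 := by
  intro h
  apply h1
  have := sum_sq_of_norm_eq_one hq
  rw [h] at this
  have hI : q.imI = 0 := by nlinarith [sq_nonneg q.imI, sq_nonneg q.imJ, sq_nonneg q.imK]
  have hJ : q.imJ = 0 := by nlinarith [sq_nonneg q.imI, sq_nonneg q.imJ, sq_nonneg q.imK]
  have hK : q.imK = 0 := by nlinarith [sq_nonneg q.imI, sq_nonneg q.imJ, sq_nonneg q.imK]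
  ext <;> simp [h, hI, hJ, hK]

/-- On the unit sphere the squared norm of the projection is $(1+\mathrm{re})/(1-\mathrm{re})$. It
determines the real part, and then the imaginary parts agree. -/
theorem stereo_injOn {a b : ℍ[ℝ]} (ha : ‖a‖ = 1) (hb : ‖b‖ = 1) (ha1 : a ≠ 1) (hb1 : b ≠ 1)
    (h : stereo a = stereo b) : a = b := by
  have ha' := sum_sq_of_norm_eq_one ha
  have hb' := sum_sq_of_norm_eq_one hb
  have hs : 1 - a.re ≠ 0 := sub_ne_zero.2 (re_ne_one ha ha1).symm
  have ht : 1 - b.re ≠ 0 := sub_ne_zero.2 (re_ne_one hb hb1).symm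
  have hI : (1 - a.re)⁻¹ * a.imI = (1 - b.re)⁻¹ * b.imI := congrArg (fun v => v 0) h
  have hJ : (1 - a.re)⁻¹ * a.imJ = (1 - b.re)⁻¹ * b.imJ := congrArg (fun v => v 1) h
  have hK : (1 - a.re)⁻¹ * a.imK = (1 - b.re)⁻¹ * b.imK := congrArg (fun v => v 2) h
  have cross : ∀ x y : ℝ, (1 - a.re)⁻¹ * x = (1 - b.re)⁻¹ * y → (1 - b.re) * x = (1 - a.re) * y := by
    intro x y hxy
    calc (1 - b.re) * x = (1 - a.re) * (1 - b.re) * ((1 - a.re)⁻¹ * x) := by field_simp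
      _ = (1 - a.re) * y := by rw [hxy]; field_simp
  replace hI := cross _ _ hI
  replace hJ := cross _ _ hJ
  replace hK := cross _ _ hK
  have hre : a.re = b.re := by
    have h1 : (1 - b.re) ^ 2 * (1 - a.re ^ 2) = (1 - a.re) ^ 2 * (1 - b.re ^ 2) := by
      linear_combination ((1 - b.re) * a.imI + (1 - a.re) * b.imI) * hI
        + ((1 - b.re) * a.imJ + (1 - a.re) * b.imJ) * hJ
        + ((1 - b.re) * a.imK + (1 - a.re) * b.imK) * hK
        - (1 - b.re) ^ 2 * ha' + (1 - a.re) ^ 2 * hb'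
    have h2 : (1 - a.re) * (1 - b.re) * (2 * (a.re - b.re)) = 0 := by linear_combination h1
    have h3 := (mul_eq_zero.1 h2).resolve_left (mul_ne_zero hs ht)
    linarith
  rw [hre] at hI hJ hK
  ext
  · exact hre
  · exact mul_left_cancel₀ ht (by linarith)
  · exact mul_left_cancel₀ ht (by linarith)
  · exact mul_left_cancel₀ ht (by linarith)

theorem norm_inv_mul_S3 (x y : S3) : ‖(x : ℍ[ℝ])⁻¹ * y‖ = 1 := by simp

theorem inv_mul_ne_one {x y : S3} (h : x ≠ y) : (x : ℍ[ℝ])⁻¹ * y ≠ 1 := by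
  intro he
  apply h
  rw [inv_mul_eq_one₀ (coe_S3_ne_zero x)] at he
  exact Subtype.ext he

theorem confDiff_ne_zero {p : Fin 3 → S3} (hp : Function.Injective p) : confDiff (incl p) ≠ 0 := by
  intro h
  have h1 := stereo_injOn (norm_inv_mul_S3 (p 0) (p 1)) (norm_inv_mul_S3 (p 0) (p 2))
    (inv_mul_ne_one (hp.ne (by decide))) (inv_mul_ne_one (hp.ne (by decide))) (sub_eq_zero.1 h)
  have h2 := mul_left_cancel₀ (inv_ne_zero (coe_S3_ne_zero (p 0))) h1
  exact hp.ne (show (1 : Fin 3) ≠ 2 by decide) (Subtype.ext h2)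

theorem contDiffAt_quaternion_inv {q : ℍ[ℝ]} (hq : q ≠ 0) :
    ContDiffAt ℝ ∞ (fun q : ℍ[ℝ] => q⁻¹) q := by
  have := contDiffAt_ringInverse ℝ (n := ∞) (Units.mk0 q hq)
  rwa [Ring.inverse_eq_inv'] at this

theorem contDiffAt_confMap {p : Fin 3 → S3} (hp : Function.Injective p) :
    ContDiffAt ℝ ∞ confMap (incl p) := by
  have hproj : ∀ i, ContDiffAt ℝ ∞ (fun q : Amb => q i) (incl p) := fun i =>
    (contDiff_apply ℝ ℍ[ℝ] i).contDiffAt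
  have hinv : ContDiffAt ℝ ∞ (fun q : Amb => (q 0)⁻¹) (incl p) :=
    ContDiffAt.comp (incl p) (contDiffAt_quaternion_inv (coe_S3_ne_zero (p 0))) (hproj 0)
  have hst : ∀ i, 0 ≠ i → ContDiffAt ℝ ∞ (fun q : Amb => stereo ((q 0)⁻¹ * q i)) (incl p) := by
    intro i hi
    refine ContDiffAt.comp (g := stereo) (incl p) (contDiffAt_stereo ?_) (hinv.mul (hproj i))
    exact re_ne_one (norm_inv_mul_S3 (p 0) (p i)) (inv_mul_ne_one (hp.ne hi))
  have hd : ContDiffAt ℝ ∞ confDiff (incl p) := (hst 1 (by decide)).sub (hst 2 (by decide))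
  have hne := confDiff_ne_zero hp
  exact ((hd.norm ℝ hne).inv (norm_ne_zero_iff.2 hne)).smul hd

theorem norm_confMap {p : Fin 3 → S3} (hp : Function.Injective p) : ‖confMap (incl p)‖ = 1 := by
  rw [confMap, norm_smul, norm_inv, norm_norm]
  exact inv_mul_cancel₀ (norm_ne_zero_iff.2 (confDiff_ne_zero hp))

end ConfMap

/-! ### An open neighbourhood of the configuration space -/

section Config

/-- The triples of nonzero quaternions with distinct directions. -/
def confCone : Set Amb := {q | (∀ i, q i ≠ 0) ∧ Function.Injective fun i => retr (q i)}

theorem incl_mem_confCone {p : Fin 3 → S3} (hp : Function.Injective p) : incl p ∈ confCone :=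
  ⟨fun i => coe_S3_ne_zero (p i), by simpa [incl] using hp⟩

theorem isOpen_confCone : IsOpen confCone := by
  rw [isOpen_iff_mem_nhds]
  rintro q ⟨h0, hinj⟩
  have hc : ∀ i, ContinuousAt (fun q : Amb => retr (q i)) q := fun i =>
    ContinuousAt.comp (f := fun q : Amb => q i) (contMDiffAt_retr (h0 i)).continuousAt
      (continuous_apply i).continuousAt
  have h1 : ∀ᶠ q' : Amb in 𝓝 q, ∀ i, q' i ≠ 0 := eventually_all.2 fun i =>
    (continuous_apply i).continuousAt.eventually_ne (h0 i)
  have h2 : ∀ᶠ q' : Amb in 𝓝 q, ∀ i j, i ≠ j → retr (q' i) ≠ retr (q' j) := by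
    refine eventually_all.2 fun i => eventually_all.2 fun j => ?_
    by_cases hij : i = j
    · exact Eventually.of_forall fun _ h => absurd hij h
    · filter_upwards [((hc i).ne_iff_eventually_ne (hc j)).1 (hinj.ne hij)] with q' hq' _ using hq'
  filter_upwards [h1, h2] with q' h1' h2'
  refine ⟨h1', fun i j h => ?_⟩
  by_contra hij
  exact h2' i j hij h

end Config

/-! ### Extending maps of the sphere to the ambient space -/

section AmbientExtension

set_option maxSynthPendingDepth 3

/-- The extension of a self-map of `S³` to the ambient space of `S³ × S³ × S³`, in each factor. -/
def ambExt (g : S3 → S3) (q : Amb) : Amb := incl fun i => g (retr (q i))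

theorem ambExt_incl (g : S3 → S3) (p : Fin 3 → S3) : ambExt g (incl p) = incl fun i => g (p i) := by
  simp [ambExt, incl]

theorem ambExt_ambExt (f g : S3 → S3) (q : Amb) : ambExt f (ambExt g q) = ambExt (f ∘ g) q := by
  simp [ambExt, incl]

theorem contDiffAt_coe_comp_retr {g : S3 → S3} (hg : ContMDiff (𝓡 3) (𝓡 3) ∞ g) {q : ℍ[ℝ]}
    (hq : q ≠ 0) : ContDiffAt ℝ ∞ (fun q => (g (retr q) : ℍ[ℝ])) q :=
  contDiffAt_comp_retr (f := fun x => (g x : ℍ[ℝ])) hq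
    (ContMDiffAt.comp _ (contMDiff_coe_S3 _) (hg _))

theorem contDiffAt_ambExt {g : S3 → S3} (hg : ContMDiff (𝓡 3) (𝓡 3) ∞ g) {q : Amb}
    (hq : ∀ i, q i ≠ 0) : ContDiffAt ℝ ∞ (ambExt g) q := by
  rw [contDiffAt_pi]
  intro i
  exact ContDiffAt.comp (g := fun q : ℍ[ℝ] => (g (retr q) : ℍ[ℝ])) (f := fun q : Amb => q i) q
    (contDiffAt_coe_comp_retr hg (hq i)) (contDiff_apply ℝ ℍ[ℝ] i).contDiffAt

theorem incl_ne_zero (p : Fin 3 → S3) (i : Fin 3) : incl p i ≠ 0 := coe_S3_ne_zero (p i)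

theorem fderiv_ambExt_apply {g : S3 → S3} (hg : ContMDiff (𝓡 3) (𝓡 3) ∞ g) (p : Fin 3 → S3)
    (u : Amb) (i : Fin 3) :
    fderiv ℝ (ambExt g) (incl p) u i =
      fderiv ℝ (fun q => (g (retr q) : ℍ[ℝ])) (p i : ℍ[ℝ]) (u i) := by
  have h1 := ((contDiffAt_ambExt hg (incl_ne_zero p)).differentiableAt (by simp)).hasFDerivAt
  have h2 := (hasFDerivAt_pi'.1 h1) i
  have h3 : HasFDerivAt (fun q => (g (retr q) : ℍ[ℝ])) _ (incl p i) :=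
    ((contDiffAt_coe_comp_retr hg (incl_ne_zero p i)).differentiableAt (by simp)).hasFDerivAt
  have h4 := h3.comp (incl p)
    (ContinuousLinearMap.proj (R := ℝ) (φ := fun _ : Fin 3 => ℍ[ℝ]) i).hasFDerivAt
  exact congrArg (fun L : Amb →L[ℝ] ℍ[ℝ] => L u) (h2.unique h4)

theorem isTangent_fderiv_ambExt {g : S3 → S3} (hg : ContMDiff (𝓡 3) (𝓡 3) ∞ g) (p : Fin 3 → S3)
    (u : Amb) : IsTangent (fun i => g (p i)) (fderiv ℝ (ambExt g) (incl p) u) := by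
  intro i
  rw [fderiv_ambExt_apply hg]
  have := inner_fderiv_eq_zero_of_norm_eq_one (F := fun q => (g (retr q) : ℍ[ℝ]))
    ((contDiffAt_coe_comp_retr hg (coe_S3_ne_zero (p i))).differentiableAt (by simp))
    (Eventually.of_forall fun z => by simp) (u i)
  simpa using this

/-- Tangent vectors are the image of the derivative of the inclusion, and `retr` is the identity on
the sphere. The radial direction is killed, which is why potentials are compared on tangent vectors
only. -/
theorem fderiv_coe_retr {x : S3} {u : ℍ[ℝ]} (hu : inner ℝ (x : ℍ[ℝ]) u = 0) :
    fderiv ℝ (fun q => (retr q : ℍ[ℝ])) (x : ℍ[ℝ]) u = u := by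
  obtain ⟨w, rfl⟩ := (range_mvfderiv_subtypeVal (n := 3) x).ge
    (Submodule.mem_orthogonal_singleton_iff_inner_right.2 hu)
  exact (mfderiv_eq_fderiv_comp_retr (contMDiff_coe_S3 x) w).symm

theorem fderiv_ambExt_id {p : Fin 3 → S3} {u : Amb} (hu : IsTangent p u) :
    fderiv ℝ (ambExt id) (incl p) u = u := by
  ext1 i
  rw [fderiv_ambExt_apply contMDiff_id]
  exact fderiv_coe_retr (hu i)

theorem isTangent_slotVec (B : VField) (p : Fin 3 → S3) (i : Fin 3) :
    IsTangent p (slotVec B p i) := by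
  intro j
  by_cases hj : j = i
  · subst hj; simpa [slotVec] using inner_coe_ambVec B (p j)
  · simp [slotVec, hj]

end AmbientExtension

/-! ### Naturality of pull-backs -/

section Pullback

set_option maxSynthPendingDepth 3

theorem pullArea_comp {Y X : Type*} [NormedAddCommGroup Y] [NormedSpace ℝ Y]
    [NormedAddCommGroup X] [NormedSpace ℝ X] {f : Y → EuclideanSpace ℝ (Fin 3)} {φ : X → Y} {x : X}
    (hf : DifferentiableAt ℝ f (φ x)) (hφ : DifferentiableAt ℝ φ x) (u v : X) :
    pullArea (fun x => f (φ x)) x u v = pullArea f (φ x) (fderiv ℝ φ x u) (fderiv ℝ φ x v) := by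
  have h : HasFDerivAt (fun x => f (φ x)) _ x := hf.hasFDerivAt.comp x hφ.hasFDerivAt
  simp only [pullArea, h.fderiv, ContinuousLinearMap.comp_apply]

theorem pullArea_slice {Z : Type*} [NormedAddCommGroup Z] [NormedSpace ℝ Z]
    {F : ℝ × Z → EuclideanSpace ℝ (Fin 3)} {t : ℝ} {z : Z} (hF : DifferentiableAt ℝ F (t, z))
    (u v : Z) : pullArea (fun z => F (t, z)) z u v = pullArea F (t, z) (0, u) (0, v) := by
  have h : HasFDerivAt (fun z => F (t, z)) _ z :=
    hF.hasFDerivAt.comp z (hasFDerivAt_prodMk_right t z)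
  simp only [pullArea, h.fderiv, ContinuousLinearMap.comp_apply, ContinuousLinearMap.inr_apply]

/-- The second derivative of `φ` enters symmetrically and cancels. -/
theorem extDerivOne_pullback {Y X : Type*} [NormedAddCommGroup Y] [NormedSpace ℝ Y]
    [NormedAddCommGroup X] [NormedSpace ℝ X] {A : Y → Y →L[ℝ] ℝ} {φ : X → Y} {x : X}
    (hA : DifferentiableAt ℝ A (φ x)) (hφ : ContDiffAt ℝ ∞ φ x) (u v : X) :
    extDerivOne (fun x => (A (φ x)).comp (fderiv ℝ φ x)) x u v =
      extDerivOne A (φ x) (fderiv ℝ φ x u) (fderiv ℝ φ x v) := by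
  have h1 := hA.hasFDerivAt.comp x (hφ.differentiableAt (by simp)).hasFDerivAt
  have h2 := ((contDiffAt_fderiv hφ).differentiableAt (by simp)).hasFDerivAt
  have h3 : HasFDerivAt (fun x => (A (φ x)).comp (fderiv ℝ φ x)) _ x := h1.clm_comp h2
  have hs : fderiv ℝ (fderiv ℝ φ) x u v = fderiv ℝ (fderiv ℝ φ) x v u :=
    (hφ.isSymmSndFDerivAt (by simpa using ENat.LEInfty.out)).eq u v
  simp only [extDerivOne, h3.fderiv]
  simp [hs]

end Pullback

/-! ### Potentials as maps to the dual space -/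

section Potentials

set_option maxSynthPendingDepth 3

/-- One-forms as functions with values in the dual space. -/
def oneForm (α : Amb → Amb [⋀^Fin 1]→L[ℝ] ℝ) (q : Amb) : Amb →L[ℝ] ℝ :=
  (ContinuousAlternatingMap.ofSubsingletonLIE (0 : Fin 1)).symm (α q)

/-- Functions with values in the dual space as one-forms. -/
def ofOneForm (A : Amb → Amb →L[ℝ] ℝ) (q : Amb) : Amb [⋀^Fin 1]→L[ℝ] ℝ :=
  ContinuousAlternatingMap.ofSubsingletonLIE (0 : Fin 1) (A q)

theorem oneForm_ofOneForm (A : Amb → Amb →L[ℝ] ℝ) : oneForm (ofOneForm A) = A := by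
  ext1 q; simp [oneForm, ofOneForm]

theorem ofOneForm_oneForm (α : Amb → Amb [⋀^Fin 1]→L[ℝ] ℝ) : ofOneForm (oneForm α) = α := by
  ext1 q; simp [oneForm, ofOneForm]

theorem oneForm_apply (α : Amb → Amb [⋀^Fin 1]→L[ℝ] ℝ) (q u : Amb) :
    oneForm α q u = α q ![u] := by
  conv_rhs => rw [← ofOneForm_oneForm α]
  rfl

theorem contDiffAt_oneForm {α : Amb → Amb [⋀^Fin 1]→L[ℝ] ℝ} {q : Amb} (h : ContDiffAt ℝ ∞ α q) :
    ContDiffAt ℝ ∞ (oneForm α) q :=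
  (ContinuousAlternatingMap.ofSubsingletonLIE (𝕜 := ℝ) (E := Amb) (F := ℝ)
    (0 : Fin 1)).symm.contDiff.contDiffAt.comp q h

theorem extDeriv_apply_eq_extDerivOne {α : Amb → Amb [⋀^Fin 1]→L[ℝ] ℝ} {q : Amb}
    (h : ContDiffAt ℝ ∞ α q) (u v : Amb) :
    extDeriv α q ![u, v] = extDerivOne (oneForm α) q u v := by
  rw [extDeriv_apply (h.differentiableAt (by simp)), Fin.sum_univ_two]
  have h1 : ∀ w z : Amb, fderiv ℝ (oneForm α) q w z = fderiv ℝ (fun q => α q ![z]) q w := by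
    intro w z
    have h2 := ((contDiffAt_oneForm h).differentiableAt (by simp)).hasFDerivAt
    have h3 : HasFDerivAt (fun q => oneForm α q z) _ q := h2.clm_apply (hasFDerivAt_const z q)
    simp only [oneForm_apply] at h3
    rw [h3.fderiv]
    simp
  have e0 : (0 : Fin 2).removeNth ![u, v] = ![v] := by
    ext1 i; fin_cases i; rfl
  have e1 : (1 : Fin 2).removeNth ![u, v] = ![u] := by
    ext1 i; fin_cases i; rfl
  rw [extDerivOne, h1, h1, e0, e1]
  simp [sub_eq_add_neg]

variable {T : Fin 3 → Set S3} {α : Amb → Amb [⋀^Fin 1]→L[ℝ] ℝ}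

theorem IsPotential.contDiffAt (hα : IsPotential T α) {p : Fin 3 → S3} (hp : p ∈ prodDomain T) :
    ContDiffAt ℝ ∞ α (incl p) := by
  obtain ⟨U, hU, hTU, hαU⟩ := hα.smooth
  exact hαU.contDiffAt (hU.mem_nhds (hTU ⟨p, hp, rfl⟩))

theorem omega_apply (q u v : Amb) : omega q ![u, v] = pullArea confMap q u v := by
  rw [pullArea, ← areaForm_apply, omega, AlternatingMap.compLinearMap_apply]
  congr 1
  ext1 i; fin_cases i <;> rfl

theorem IsPotential.extDerivOne_eq (hα : IsPotential T α) {p : Fin 3 → S3} (hp : p ∈ prodDomain T)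
    {u v : Amb} (hu : IsTangent p u) (hv : IsTangent p v) :
    extDerivOne (oneForm α) (incl p) u v = pullArea confMap (incl p) u v := by
  rw [← extDeriv_apply_eq_extDerivOne (hα.contDiffAt hp), hα.extDeriv_eq p hp u v hu hv,
    omega_apply]

theorem isPotential_ofOneForm {A : Amb → Amb →L[ℝ] ℝ} {U : Set Amb} (hU : IsOpen U)
    (hTU : ∀ p ∈ prodDomain T, incl p ∈ U) (hA : ContDiffOn ℝ ∞ A U)
    (h : ∀ p ∈ prodDomain T, ∀ u v : Amb, IsTangent p u → IsTangent p v →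
      extDerivOne A (incl p) u v = pullArea confMap (incl p) u v) :
    IsPotential T (ofOneForm A) := by
  have hs : ContDiffOn ℝ ∞ (ofOneForm A) U :=
    (ContinuousAlternatingMap.ofSubsingletonLIE (𝕜 := ℝ) (E := Amb) (F := ℝ)
      (0 : Fin 1)).contDiff.comp_contDiffOn hA
  refine ⟨⟨U, hU, ?_, hs⟩, ?_⟩
  · rintro _ ⟨p, hp, rfl⟩; exact hTU p hp
  · intro p hp u v hu hv
    rw [extDeriv_apply_eq_extDerivOne (hs.contDiffAt (hU.mem_nhds (hTU p hp))),
      oneForm_ofOneForm, h p hp u v hu hv, omega_apply]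

theorem IsPotential.density_eq (hα : IsPotential T α) (B : VField) {p : Fin 3 → S3}
    (hp : p ∈ prodDomain T) :
    density (helicityForm B α) p = wedgeSlots B (oneForm α) (oneForm α) p := by
  simp only [density_helicityForm, wedgeSlots, oneForm_apply,
    extDeriv_apply_eq_extDerivOne (hα.contDiffAt hp)]

theorem IsPotential.helicity_eq (hα : IsPotential T α) (B : VField) (hT : ∀ i, IsHandlebody (T i)) :
    helicity B T α = ∫ p in prodDomain T, wedgeSlots B (oneForm α) (oneForm α) p ∂vol3 :=
  setIntegral_congr_fun (isCompact_prodDomain hT).isClosed.measurableSet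
    fun _ hp => hα.density_eq B hp

end Potentials

/-! ### Push-forward of fields, flows and handlebodies -/

section PushForward

theorem isInvertible_mfderiv_diffS3 (g : DiffS3) (x : S3) :
    (mfderiv (𝓡 3) (𝓡 3) g x).IsInvertible :=
  ⟨g.mfderivToContinuousLinearEquiv (by simp) x, rfl⟩

theorem DiffS3.mdifferentiableAt (g : DiffS3) (x : S3) :
    MDifferentiableAt (𝓡 3) (𝓡 3) g x :=
  g.contMDiff.contMDiffAt.mdifferentiableAt (by simp)

theorem pushForward_apply (g : DiffS3) (B : VField) (x : S3) :
    pushForward g B (g x) = mfderiv (𝓡 3) (𝓡 3) g x (B x) := by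
  have h1 := (DiffS3.mdifferentiableAt g x).hasMFDerivAt
  have h2 := (DiffS3.mdifferentiableAt g.symm (g x)).hasMFDerivAt
  have h3 := (h2.comp x h1).congr_of_eventuallyEq (f₁ := id)
    (Eventually.of_forall fun y => by simp)
  have h4 := hasMFDerivAt_unique h3 (hasMFDerivAt_id x)
  have h5 : mfderiv (𝓡 3) (𝓡 3) g.symm (g x) (mfderiv (𝓡 3) (𝓡 3) g x (B x)) = B x :=
    congrArg (fun L : TangentSpace (𝓡 3) x →L[ℝ] TangentSpace (𝓡 3) x => L (B x)) h4
  -- The two values lie in different tangent spaces, and are compared in the common model space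
  -- $\mathbb R^3$.
  have h6 : ∀ z, z = x → (B z : EuclideanSpace ℝ (Fin 3)) = B x := by
    rintro z rfl; rfl
  rw [pushForward, VectorField.mpullback_apply,
    (isInvertible_mfderiv_diffS3 g.symm (g x)).inverse_apply_eq]
  exact (h6 _ (g.symm_apply_apply x)).trans h5.symm

theorem IsMIntegralCurve.pushForward {B : VField} {γ : ℝ → S3}
    (hγ : IsMIntegralCurve (I := 𝓡 3) γ B) (g : DiffS3) :
    IsMIntegralCurve (I := 𝓡 3) (fun t => g (γ t)) (pushForward g B) := by
  intro t
  have h := (DiffS3.mdifferentiableAt g (γ t)).hasMFDerivAt.comp t (hγ t)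
  have e : (mfderiv (𝓡 3) (𝓡 3) g (γ t)).comp ((1 : ℝ →L[ℝ] ℝ).smulRight (B (γ t))) =
      (1 : ℝ →L[ℝ] ℝ).smulRight (Helicity.pushForward g B (g (γ t))) := by
    rw [pushForward_apply]
    ext
    simp
  exact HasMFDerivAt.congr_mfderiv h e

theorem measurePreserving_symm {g : DiffS3} (hg : MeasurePreserving g vol vol) :
    MeasurePreserving g.symm vol vol := by
  have h : MeasurePreserving g.toHomeomorph.toMeasurableEquiv vol vol := hg
  exact h.symm

theorem IsSVect.pushForward {B : VField} (hB : IsSVect B) {g : DiffS3}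
    (hg : MeasurePreserving g vol vol) : IsSVect (pushForward g B) := by
  refine ⟨?_, ?_⟩
  · exact ContMDiff.mpullback_vectorField (n := ∞) hB.smooth g.symm.contMDiff
      (isInvertible_mfderiv_diffS3 g.symm) (by simp)
  · obtain ⟨Φ, h0, hΦ, hm⟩ := hB.flow
    refine ⟨fun t y => g (Φ t (g.symm y)), fun y => by simp [h0], fun y => ?_, fun t => ?_⟩
    · exact IsMIntegralCurve.pushForward (hΦ (g.symm y)) g
    · exact hg.comp ((hm t).comp (measurePreserving_symm hg))

theorem IsBoundaryDefining.comp_diffeo {T U : Set S3} {f : S3 → ℝ} (g : DiffS3) {x : S3}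
    (h : IsBoundaryDefining T (g x) U f) :
    IsBoundaryDefining (g ⁻¹' T) x (g ⁻¹' U) (fun y => f (g y)) := by
  refine ⟨h.isOpen.preimage g.continuous, h.mem, ?_, h.apply_eq_zero, ?_, fun y hy => h.mem_iff _ hy⟩
  · exact h.smooth.comp g.contMDiff.contMDiffOn (fun y hy => hy)
  · intro h0
    apply h.mfderiv_ne_zero
    have hf : MDifferentiableAt (𝓡 3) 𝓘(ℝ, ℝ) f (g x) :=
      (h.smooth.contMDiffAt (h.isOpen.mem_nhds h.mem)).mdifferentiableAt (by simp)
    have h1 := mfderiv_comp x hf (DiffS3.mdifferentiableAt g x)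
    ext w
    obtain ⟨v, rfl⟩ := (isInvertible_mfderiv_diffS3 g x).surjective w
    have h2 := congrArg (fun L : TangentSpace (𝓡 3) x →L[ℝ] ℝ => L v) (h1.symm.trans h0)
    exact h2

theorem IsHandlebody.image {T : Set S3} (hT : IsHandlebody T) (g : DiffS3) :
    IsHandlebody (g '' T) := by
  refine ⟨?_, ?_⟩
  · obtain ⟨n, ⟨e⟩⟩ := hT.model
    exact ⟨n, ⟨(g.toHomeomorph.image T).symm.trans e⟩⟩
  · intro y hy
    obtain ⟨x, hx, rfl⟩ : y ∈ g '' frontier T := by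
      rw [← g.coe_toHomeomorph, g.toHomeomorph.image_frontier]; exact hy
    obtain ⟨U, f, hf⟩ := hT.smooth_boundary x hx
    rw [g.image_eq_preimage_symm]
    exact ⟨_, _, IsBoundaryDefining.comp_diffeo g.symm (by rwa [g.symm_apply_apply])⟩

theorem IsTangentToBoundary.pushForward {B : VField} {T : Set S3} (hB : IsTangentToBoundary B T)
    (g : DiffS3) : IsTangentToBoundary (pushForward g B) (g '' T) := by
  intro y hy U f hf
  obtain ⟨x, hx, rfl⟩ : y ∈ g '' frontier T := by
    rw [← g.coe_toHomeomorph, g.toHomeomorph.image_frontier]; exact hy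
  have h1 := IsBoundaryDefining.comp_diffeo g hf
  have hT : g ⁻¹' (g '' T) = T := Set.preimage_image_eq T g.injective
  rw [hT] at h1
  have h2 := hB x hx _ _ h1
  have hfd : MDifferentiableAt (𝓡 3) 𝓘(ℝ, ℝ) f (g x) :=
    (hf.smooth.contMDiffAt (hf.isOpen.mem_nhds hf.mem)).mdifferentiableAt (by simp)
  have h3 := mfderiv_comp x hfd (DiffS3.mdifferentiableAt g x)
  have h4 := congrArg (fun L : TangentSpace (𝓡 3) x →L[ℝ] ℝ => L (B x)) h3
  rw [pushForward_apply]
  exact h4.symm.trans h2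

theorem slotVec_pushForward {B : VField} (hB : IsSVect B) (g : DiffS3) (p : Fin 3 → S3)
    (i : Fin 3) :
    slotVec (pushForward g B) (fun j => g (p j)) i =
      fderiv ℝ (ambExt g) (incl p) (slotVec B p i) := by
  obtain ⟨Φ, h0, hΦ, -⟩ := hB.flow
  -- Both sides are the velocity at time `0` of the curve $g(\Phi_t x)$: once as an integral curve
  -- of $g_*B$, once by the chain rule.
  have key : ∀ x, ambVec (pushForward g B) (g x) =
      fderiv ℝ (fun q => (g (retr q) : ℍ[ℝ])) (x : ℍ[ℝ]) (ambVec B x) := by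
    intro x
    have h1 := hasDerivAt_coe_integralCurve (IsMIntegralCurve.pushForward (hΦ x) g) 0
    have h2 := hasDerivAt_coe_integralCurve (hΦ x) 0
    have h3 := ((contDiffAt_coe_comp_retr g.contMDiff (coe_S3_ne_zero (Φ 0 x))).differentiableAt
      (by simp)).hasFDerivAt.comp_hasDerivAt 0 h2
    have h4 : HasDerivAt (fun s => (g (Φ s x) : ℍ[ℝ]))
        (fderiv ℝ (fun q => (g (retr q) : ℍ[ℝ])) (Φ 0 x : ℍ[ℝ]) (ambVec B (Φ 0 x))) 0 := by
      simpa [Function.comp_def] using h3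
    have h5 := h1.unique h4
    rwa [h0] at h5
  ext1 j
  rw [fderiv_ambExt_apply g.contMDiff]
  by_cases hj : j = i
  · subst hj; simp [slotVec, key]
  · simp [slotVec, hj]

end PushForward

/-! ### The isotopy as a smooth family over the whole time line -/

section Isotopy

set_option maxSynthPendingDepth 3

/-- The map `(t, q) ↦ H(G_t(q / |q|))`, with time reparametrized so that it is defined for all
`t`. -/
def isoMap (G : ℝ → DiffS3) (y : ℝ × Amb) : EuclideanSpace ℝ (Fin 3) :=
  confMap (ambExt (G (Real.smoothTransition y.1)) y.2)

/-- The reparametrised time stays in `[0, 1]`, so smoothness of the isotopy within this interval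
gives smoothness at every real `t`, endpoints included. -/
theorem contDiffAt_isotopy {G : ℝ → DiffS3}
    (hG : ContMDiffOn (𝓘(ℝ, ℝ).prod (𝓡 3)) (𝓡 3) ∞ (fun q : ℝ × S3 => G q.1 q.2)
      (Set.Icc (0 : ℝ) 1 ×ˢ Set.univ)) (t : ℝ) {q : ℍ[ℝ]} (hq : q ≠ 0) :
    ContDiffAt ℝ ∞ (fun y : ℝ × ℍ[ℝ] => (G (Real.smoothTransition y.1) (retr y.2) : ℍ[ℝ]))
      (t, q) := by
  have h1 : ContMDiffAt 𝓘(ℝ, ℝ × ℍ[ℝ]) (𝓘(ℝ, ℝ).prod (𝓡 3)) ∞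
      (fun y : ℝ × ℍ[ℝ] => (Real.smoothTransition y.1, retr y.2)) (t, q) := by
    refine ContMDiffAt.prodMk ?_ ?_
    · exact ((Real.smoothTransition.contDiff (n := ⊤)).comp contDiff_fst).contMDiff.contMDiffAt
    · exact ContMDiffAt.comp (t, q) (contMDiffAt_retr hq) contDiff_snd.contMDiff.contMDiffAt
  have h2 := (hG (Real.smoothTransition t, retr q)
    ⟨⟨Real.smoothTransition.nonneg t, Real.smoothTransition.le_one t⟩, trivial⟩)
  have hm : Set.MapsTo (fun y : ℝ × ℍ[ℝ] => (Real.smoothTransition y.1, retr y.2)) Set.univ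
      (Set.Icc (0 : ℝ) 1 ×ˢ Set.univ) := fun y _ =>
    ⟨⟨Real.smoothTransition.nonneg y.1, Real.smoothTransition.le_one y.1⟩, trivial⟩
  have h3 : ContMDiffWithinAt 𝓘(ℝ, ℝ × ℍ[ℝ]) (𝓡 3) ∞
      (fun y : ℝ × ℍ[ℝ] => G (Real.smoothTransition y.1) (retr y.2)) Set.univ (t, q) :=
    ContMDiffWithinAt.comp (t, q) h2 h1.contMDiffWithinAt hm
  rw [contMDiffWithinAt_univ] at h3
  exact (ContMDiffAt.comp (t, q) (contMDiff_coe_S3 _) h3).contDiffAt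

theorem contDiffOn_isoMap {G : ℝ → DiffS3}
    (hG : ContMDiffOn (𝓘(ℝ, ℝ).prod (𝓡 3)) (𝓡 3) ∞ (fun q : ℝ × S3 => G q.1 q.2)
      (Set.Icc (0 : ℝ) 1 ×ˢ Set.univ)) :
    ContDiffOn ℝ ∞ (isoMap G) (Set.univ ×ˢ confCone) := by
  rintro ⟨t, q⟩ ⟨-, h0, hinj⟩
  have h1 : ContDiffAt ℝ ∞ (fun y : ℝ × Amb => ambExt (G (Real.smoothTransition y.1)) y.2) (t, q) := by
    rw [contDiffAt_pi]
    intro i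
    exact ContDiffAt.comp (g := fun y : ℝ × ℍ[ℝ] =>
        (G (Real.smoothTransition y.1) (retr y.2) : ℍ[ℝ]))
      (f := fun y : ℝ × Amb => (y.1, y.2 i)) (t, q) (contDiffAt_isotopy hG t (h0 i))
      (contDiffAt_fst.prodMk ((contDiff_apply ℝ ℍ[ℝ] i).contDiffAt.comp (t, q) contDiffAt_snd))
  exact (ContDiffAt.comp (g := confMap) (t, q)
    (contDiffAt_confMap ((G _).injective.comp hinj)) h1).contDiffWithinAt

theorem norm_isoMap (G : ℝ → DiffS3) : ∀ y ∈ Set.univ ×ˢ confCone, ‖isoMap G y‖ = 1 := by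
  rintro ⟨t, q⟩ ⟨-, h0, hinj⟩
  exact norm_confMap ((G _).injective.comp hinj)

theorem injective_of_mem_prodDomain {T : Fin 3 → Set S3}
    (hT : ∀ i j, i ≠ j → Disjoint (T i) (T j)) {p : Fin 3 → S3} (hp : p ∈ prodDomain T) :
    Function.Injective p := by
  intro i j h
  by_contra hij
  exact Set.disjoint_left.1 (hT i j hij) (hp i trivial) (h ▸ hp j trivial)

theorem pullArea_isoMap {G : ℝ → DiffS3}
    (hG : ContMDiffOn (𝓘(ℝ, ℝ).prod (𝓡 3)) (𝓡 3) ∞ (fun q : ℝ × S3 => G q.1 q.2)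
      (Set.Icc (0 : ℝ) 1 ×ˢ Set.univ)) {t : ℝ} {f : S3 → S3}
    (hf : ∀ x, G (Real.smoothTransition t) x = f x) {p : Fin 3 → S3} (hp : Function.Injective p)
    (u v : Amb) :
    pullArea (isoMap G) (t, incl p) (0, u) (0, v) =
      pullArea confMap (incl fun i => f (p i)) (fderiv ℝ (ambExt f) (incl p) u)
        (fderiv ℝ (ambExt f) (incl p) v) := by
  obtain rfl : ⇑(G (Real.smoothTransition t)) = f := funext hf
  have hd : DifferentiableAt ℝ (isoMap G) (t, incl p) :=
    (contDiffAt_of_contDiffOn_univ_prod isOpen_confCone (contDiffOn_isoMap hG) t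
      (incl_mem_confCone hp)).differentiableAt (by simp)
  rw [← pullArea_slice hd]
  have h1 := contDiffAt_ambExt (G (Real.smoothTransition t)).contMDiff (incl_ne_zero p)
  have h2 : DifferentiableAt ℝ confMap (ambExt (G (Real.smoothTransition t)) (incl p)) := by
    rw [ambExt_incl]
    exact (contDiffAt_confMap ((G _).injective.comp hp)).differentiableAt (by simp)
  have h3 := pullArea_comp h2 (h1.differentiableAt (by simp)) u v
  rw [ambExt_incl] at h3
  exact h3

end Isotopy

/-! ### Pull-back of one-forms by maps of the sphere -/

section PullForm

set_option maxSynthPendingDepth 3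

/-- The pull-back of a one-form by a self-map of `S³`, applied in each factor of
`S³ × S³ × S³`. -/
def pullForm (f : S3 → S3) (A : Amb → Amb →L[ℝ] ℝ) (q : Amb) : Amb →L[ℝ] ℝ :=
  (A (ambExt f q)).comp (fderiv ℝ (ambExt f) q)

theorem contDiffAt_pullForm {f : S3 → S3} (hf : ContMDiff (𝓡 3) (𝓡 3) ∞ f)
    {A : Amb → Amb →L[ℝ] ℝ} {q : Amb} (hq : ∀ i, q i ≠ 0) (hA : ContDiffAt ℝ ∞ A (ambExt f q)) :
    ContDiffAt ℝ ∞ (pullForm f A) q :=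
  (hA.comp q (contDiffAt_ambExt hf hq)).clm_comp (contDiffAt_fderiv (contDiffAt_ambExt hf hq))

theorem extDerivOne_pullForm {f : S3 → S3} (hf : ContMDiff (𝓡 3) (𝓡 3) ∞ f)
    {A : Amb → Amb →L[ℝ] ℝ} {p : Fin 3 → S3} (hA : ContDiffAt ℝ ∞ A (incl fun i => f (p i)))
    (u v : Amb) :
    extDerivOne (pullForm f A) (incl p) u v = extDerivOne A (incl fun i => f (p i))
      (fderiv ℝ (ambExt f) (incl p) u) (fderiv ℝ (ambExt f) (incl p) v) := by
  rw [← ambExt_incl] at hA ⊢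
  exact extDerivOne_pullback (hA.differentiableAt (by simp))
    (contDiffAt_ambExt hf (incl_ne_zero p)) u v

theorem wedgeSlots_pushForward {B : VField} (hB : IsSVect B) (g : DiffS3)
    {A : Amb → Amb →L[ℝ] ℝ} {p : Fin 3 → S3} (hA : ContDiffAt ℝ ∞ A (incl fun i => g (p i))) :
    wedgeSlots (pushForward g B) A A (fun i => g (p i)) =
      wedgeSlots B (pullForm g A) (pullForm g A) p := by
  simp only [wedgeSlots, extDerivOne_pullForm g.contMDiff hA, slotVec_pushForward hB, pullForm,
    ambExt_incl, ContinuousLinearMap.comp_apply]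

/-- The two extensions compose to the radial retraction `ambExt id`, not to the identity. Its
derivative fixes tangent vectors. -/
theorem fderiv_ambExt_symm (g : DiffS3) {p : Fin 3 → S3} {u : Amb}
    (hu : IsTangent (fun i => g (p i)) u) :
    fderiv ℝ (ambExt g) (incl p) (fderiv ℝ (ambExt g.symm) (incl fun i => g (p i)) u) = u := by
  have h1 := ((contDiffAt_ambExt g.symm.contMDiff (incl_ne_zero fun i => g (p i))).differentiableAt
    (by simp)).hasFDerivAt
  have e : ambExt g.symm (incl fun i => g (p i)) = incl p := by simp [ambExt_incl]
  have h2 := ((contDiffAt_ambExt g.contMDiff (incl_ne_zero p)).differentiableAt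
    (by simp)).hasFDerivAt
  rw [← e] at h2
  have h3 := h2.comp _ h1
  have h4 : ambExt g ∘ ambExt g.symm = ambExt id := by
    ext1 q
    rw [Function.comp_apply, ambExt_ambExt]
    congr 1
    ext1 x
    simp
  rw [h4, e] at h3
  conv_rhs => rw [← fderiv_ambExt_id hu, h3.fderiv]
  rfl

theorem isOpen_ambExt_preimage {f : S3 → S3} (hf : ContMDiff (𝓡 3) (𝓡 3) ∞ f) {U : Set Amb}
    (hU : IsOpen U) : IsOpen {q : Amb | (∀ i, q i ≠ 0) ∧ ambExt f q ∈ U} := by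
  rw [isOpen_iff_mem_nhds]
  rintro q ⟨h0, hq⟩
  have h1 : ∀ᶠ z in 𝓝 q, ∀ i, z i ≠ 0 :=
    eventually_all.2 fun i => (continuous_apply i).continuousAt.eventually_ne (h0 i)
  exact h1.and ((contDiffAt_ambExt hf h0).continuousAt.eventually (hU.mem_nhds hq))

end PullForm

/-! ### Invariance of the helicity -/

section Invariance

set_option maxSynthPendingDepth 3

variable {B : VField} {T : Fin 3 → Set S3}

theorem pullArea_isoMap_zero {G : ℝ → DiffS3}
    (hG : ContMDiffOn (𝓘(ℝ, ℝ).prod (𝓡 3)) (𝓡 3) ∞ (fun q : ℝ × S3 => G q.1 q.2)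
      (Set.Icc (0 : ℝ) 1 ×ˢ Set.univ)) (hG0 : ∀ x, G 0 x = x) {p : Fin 3 → S3}
    (hp : Function.Injective p) {u v : Amb} (hu : IsTangent p u) (hv : IsTangent p v) :
    pullArea (isoMap G) (0, incl p) (0, u) (0, v) = pullArea confMap (incl p) u v := by
  rw [pullArea_isoMap hG (f := id) (by simpa [Real.smoothTransition.zero_of_nonpos] using hG0) hp,
    fderiv_ambExt_id hu, fderiv_ambExt_id hv]
  rfl

/-- On tangent vectors $d(\alpha+\kappa_1)=\omega_0+(\omega_1-\omega_0)=\omega_1$, and $\omega_1$ is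
the pull-back of $\omega$ by $g$. Both the existence of a potential on the image and the comparison
of helicities rest on this. -/
theorem extDerivOne_add_kappaForm {G : ℝ → DiffS3}
    (hG : ContMDiffOn (𝓘(ℝ, ℝ).prod (𝓡 3)) (𝓡 3) ∞ (fun q : ℝ × S3 => G q.1 q.2)
      (Set.Icc (0 : ℝ) 1 ×ˢ Set.univ)) (hG0 : ∀ x, G 0 x = x) {g : DiffS3} (hG1 : ∀ x, G 1 x = g x)
    (hT : ∀ i j, i ≠ j → Disjoint (T i) (T j)) {α : Amb → Amb [⋀^Fin 1]→L[ℝ] ℝ}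
    (hα : IsPotential T α) {p : Fin 3 → S3} (hp : p ∈ prodDomain T) {u v : Amb}
    (hu : IsTangent p u) (hv : IsTangent p v) :
    extDerivOne (fun q => oneForm α q + kappaForm (isoMap G) 1 q) (incl p) u v =
      pullArea confMap (incl fun i => g (p i)) (fderiv ℝ (ambExt g) (incl p) u)
        (fderiv ℝ (ambExt g) (incl p) v) := by
  have hi := injective_of_mem_prodDomain hT hp
  have h1 := (contDiffAt_oneForm (hα.contDiffAt hp)).differentiableAt (by simp)
  have h2 := (contDiffAt_kappaForm isOpen_confCone (contDiffOn_isoMap hG) 1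
    (incl_mem_confCone hi)).differentiableAt (by simp)
  have h3 : extDerivOne (fun q => oneForm α q + kappaForm (isoMap G) 1 q) (incl p) u v =
      extDerivOne (oneForm α) (incl p) u v + extDerivOne (kappaForm (isoMap G) 1) (incl p) u v := by
    simp only [extDerivOne, fderiv_fun_add h1 h2, add_apply]
    ring
  rw [h3, extDerivOne_kappaForm isOpen_confCone (contDiffOn_isoMap hG) (norm_isoMap G)
    (incl_mem_confCone hi), hα.extDerivOne_eq hp hu hv,
    pullArea_isoMap hG (f := g) (by simpa [Real.smoothTransition.one_of_one_le] using hG1) hi,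
    pullArea_isoMap_zero hG hG0 hi hu hv, add_sub_cancel]

theorem exists_isPotential_image (hT : ∀ i j, i ≠ j → Disjoint (T i) (T j)) {g : DiffS3}
    (hg : IsSDiff0 g) (h : ∃ α, IsPotential T α) : ∃ α, IsPotential (fun i => g '' T i) α := by
  obtain ⟨α, hα⟩ := h
  obtain ⟨G, hG, hG0, hG1⟩ := hg.isotopic
  obtain ⟨U, hU, hTU, hαU⟩ := hα.smooth
  have hA : ∀ q ∈ U ∩ confCone,
      ContDiffAt ℝ ∞ (fun q => oneForm α q + kappaForm (isoMap G) 1 q) q := fun q hq =>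
    (contDiffAt_oneForm (hαU.contDiffAt (hU.mem_nhds hq.1))).add
      (contDiffAt_kappaForm isOpen_confCone (contDiffOn_isoMap hG) 1 hq.2)
  have hTW : ∀ p ∈ prodDomain T, incl p ∈ U ∩ confCone := fun p hp =>
    ⟨hTU ⟨p, hp, rfl⟩, incl_mem_confCone (injective_of_mem_prodDomain hT hp)⟩
  have hs : ∀ p ∈ prodDomain fun i => g '' T i, ∃ p₀ ∈ prodDomain T, p = fun i => g (p₀ i) := by
    intro p hp
    choose p₀ h₀ h₁ using fun i => hp i trivial
    exact ⟨p₀, fun i _ => h₀ i, (funext h₁).symm⟩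
  -- The potential on the image is $(g^{-1})^*(\alpha+\kappa_1)$.
  refine ⟨_, isPotential_ofOneForm
    (A := pullForm g.symm fun q => oneForm α q + kappaForm (isoMap G) 1 q)
    (isOpen_ambExt_preimage g.symm.contMDiff (hU.inter isOpen_confCone)) ?_ ?_ ?_⟩
  · intro p hp
    obtain ⟨p, hp₀, rfl⟩ := hs p hp
    refine ⟨incl_ne_zero _, ?_⟩
    rw [ambExt_incl]
    simpa using hTW p hp₀
  · exact fun q hq => (contDiffAt_pullForm g.symm.contMDiff hq.1 (hA _ hq.2)).contDiffWithinAt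
  · intro p hp u v hu hv
    obtain ⟨p, hp₀, rfl⟩ := hs p hp
    have e : (fun i => g.symm (g (p i))) = p := by simp
    rw [extDerivOne_pullForm g.symm.contMDiff (by rw [e]; exact hA _ (hTW p hp₀))]
    have h1 := isTangent_fderiv_ambExt g.symm.contMDiff (fun i => g (p i)) u
    have h2 := isTangent_fderiv_ambExt g.symm.contMDiff (fun i => g (p i)) v
    rw [e] at h1 h2 ⊢
    rw [extDerivOne_add_kappaForm hG hG0 hG1 hT hα hp₀ h1 h2, fderiv_ambExt_symm g hu,
      fderiv_ambExt_symm g hv]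

theorem prodDomain_image (g : DiffS3) (T : Fin 3 → Set S3) :
    prodDomain (fun i => g '' T i) = (fun p i => g (p i)) '' prodDomain T :=
  (Set.piMap_image_univ_pi (fun _ => g) T).symm

theorem setIntegral_prodDomain_image {g : DiffS3} (hg : MeasurePreserving g vol vol)
    (f : (Fin 3 → S3) → ℝ) :
    ∫ p in prodDomain (fun i => g '' T i), f p ∂vol3 =
      ∫ p in prodDomain T, f (fun i => g (p i)) ∂vol3 := by
  have hm : MeasurePreserving (fun (p : Fin 3 → S3) i => g (p i)) vol3 vol3 :=
    measurePreserving_pi _ _ fun _ => hg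
  rw [prodDomain_image]
  exact hm.setIntegral_image_emb
    (Homeomorph.piCongrRight fun _ : Fin 3 => g.toHomeomorph).measurableEmbedding f _

theorem helicity_eq_of_isPotential (hB : IsSVect B) (hT : IsInvariantUnlinkedHandlebody B T)
    {α α' : Amb → Amb [⋀^Fin 1]→L[ℝ] ℝ} (hα : IsPotential T α) (hα' : IsPotential T α') :
    helicity B T α = helicity B T α' := by
  rw [hα.helicity_eq B hT.handlebody, hα'.helicity_eq B hT.handlebody]
  refine integral_wedgeSlots_eq_of_extDerivOne_eq hB hT.handlebody hT.tangent
    (fun p hp => contDiffAt_oneForm (hα.contDiffAt hp))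
    (fun p hp => contDiffAt_oneForm (hα'.contDiffAt hp)) fun p hp i j => ?_
  rw [hα.extDerivOne_eq hp (isTangent_slotVec B p i) (isTangent_slotVec B p j),
    hα'.extDerivOne_eq hp (isTangent_slotVec B p i) (isTangent_slotVec B p j)]

theorem integrableOn_density (hB : IsSVect B) (hT : ∀ i, IsHandlebody (T i))
    {α : Amb → Amb [⋀^Fin 1]→L[ℝ] ℝ} (hα : IsPotential T α) :
    IntegrableOn (density (helicityForm B α)) (prodDomain T) vol3 :=
  integrableOn_of_continuousOn_prodDomain hT
    ((continuousOn_wedgeSlots hB (fun _ hp => contDiffAt_oneForm (hα.contDiffAt hp))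
      (fun _ hp => contDiffAt_oneForm (hα.contDiffAt hp))).congr fun _ hp => hα.density_eq B hp)

theorem IsInvariantUnlinkedHandlebody.image (hT : IsInvariantUnlinkedHandlebody B T) {g : DiffS3}
    (hg : IsSDiff0 g) :
    IsInvariantUnlinkedHandlebody (pushForward g B) (fun i => g '' T i) where
  disjoint i j hij := (Set.disjoint_image_iff g.injective).2 (hT.disjoint i j hij)
  handlebody i := (hT.handlebody i).image g
  exact := exists_isPotential_image hT.disjoint hg hT.exact
  tangent i := (hT.tangent i).pushForward g

theorem helicity_pushForward (hB : IsSVect B) (hT : IsInvariantUnlinkedHandlebody B T)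
    {g : DiffS3} (hg : IsSDiff0 g) {α α' : Amb → Amb [⋀^Fin 1]→L[ℝ] ℝ} (hα : IsPotential T α)
    (hα' : IsPotential (fun i => g '' T i) α') :
    helicity B T α = helicity (pushForward g B) (fun i => g '' T i) α' := by
  obtain ⟨G, hG, hG0, hG1⟩ := hg.isotopic
  have hF := contDiffOn_isoMap hG
  have hTW : ∀ p ∈ prodDomain T, incl p ∈ confCone := fun p hp =>
    incl_mem_confCone (injective_of_mem_prodDomain hT.disjoint hp)
  have hα'c : ∀ p ∈ prodDomain T, ContDiffAt ℝ ∞ (oneForm α') (incl fun i => g (p i)) :=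
    fun p hp => contDiffAt_oneForm (hα'.contDiffAt fun i _ => ⟨p i, hp i trivial, rfl⟩)
  rw [hα.helicity_eq B hT.handlebody, hα'.helicity_eq _ (hT.image hg).handlebody,
    setIntegral_prodDomain_image hg.measurePreserving,
    ← integral_wedgeSlots_add_kappaForm hB hT.handlebody hT.tangent isOpen_confCone hTW hF
      (norm_isoMap G) (fun p hp => contDiffAt_oneForm (hα.contDiffAt hp)) ?_ 1]
  · have hm : MeasurableSet (prodDomain T) :=
      (isCompact_prodDomain hT.handlebody).isClosed.measurableSet
    rw [setIntegral_congr_fun hm fun p hp => wedgeSlots_pushForward hB g (hα'c p hp)]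
    -- Both integrals are now over the original domain, for the forms $\alpha+\kappa_1$ and
    -- $g^*\alpha'$. These have the same exterior derivative $g^*\omega$ on the $B_i$.
    refine integral_wedgeSlots_eq_of_extDerivOne_eq hB hT.handlebody hT.tangent ?_ ?_ ?_
    · exact fun p hp => (contDiffAt_oneForm (hα.contDiffAt hp)).add
        (contDiffAt_kappaForm isOpen_confCone hF 1 (hTW p hp))
    · exact fun p hp => contDiffAt_pullForm g.contMDiff (incl_ne_zero p)
        (by rw [ambExt_incl]; exact hα'c p hp)
    · intro p hp i j
      rw [extDerivOne_add_kappaForm hG hG0 hG1 hT.disjoint hα hp (isTangent_slotVec B p i)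
        (isTangent_slotVec B p j), extDerivOne_pullForm g.contMDiff (hα'c p hp),
        hα'.extDerivOne_eq (fun i _ => ⟨p i, hp i trivial, rfl⟩)
          (isTangent_fderiv_ambExt g.contMDiff p _) (isTangent_fderiv_ambExt g.contMDiff p _)]
  · intro p hp i j
    rw [hα.extDerivOne_eq hp (isTangent_slotVec B p i) (isTangent_slotVec B p j),
      pullArea_isoMap_zero hG hG0 (injective_of_mem_prodDomain hT.disjoint hp)
        (isTangent_slotVec B p i) (isTangent_slotVec B p j)]

end Invariance

end Helicity

end

theorem mainTheorem2 (B : Helicity.VField) (hB : Helicity.IsSVect B)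
    (T : Fin 3 → Set Helicity.S3) (hT : Helicity.IsInvariantUnlinkedHandlebody B T) :
    (∀ α, Helicity.IsPotential T α →
      IntegrableOn (Helicity.density (Helicity.helicityForm B α)) (Helicity.prodDomain T)
        Helicity.vol3) ∧
    (∀ α α', Helicity.IsPotential T α → Helicity.IsPotential T α' →
      Helicity.helicity B T α = Helicity.helicity B T α') ∧
    (∀ g : Helicity.DiffS3, Helicity.IsSDiff0 g →
      Helicity.IsSVect (Helicity.pushForward g B) ∧
      Helicity.IsInvariantUnlinkedHandlebody (Helicity.pushForward g B) (fun i => g '' T i) ∧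
      ∀ α α', Helicity.IsPotential T α → Helicity.IsPotential (fun i => g '' T i) α' →
        Helicity.helicity B T α =
          Helicity.helicity (Helicity.pushForward g B) (fun i => g '' T i) α') :=
  ⟨fun _ hα => Helicity.integrableOn_density hB hT.handlebody hα,
    fun _ _ hα hα' => Helicity.helicity_eq_of_isPotential hB hT hα hα',
    fun _ hg => ⟨hB.pushForward hg.measurePreserving, hT.image hg,
      fun _ _ hα hα' => Helicity.helicity_pushForward hB hT hg hα hα'⟩⟩
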